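/- Let $N\ge 1$, $m\ge 0$ and $A,B\in\mathbb C^{N\times N}$. Consider the star graph with one vertex and $N$ outgoing half-lines $e_1,\dots,e_N$, each parametrized by $(0,\infty)$. In $\mathscr H=\bigoplus_{l=1}^N L^2((0,\infty);\mathbb C^2)$ let $D^{max}$ act on every edge as $-i\,\partial\otimes\sigma_1+m\otimes\sigma_3$, i.e. $(\phi^1,\phi^2)\mapsto(-i\partial\phi^2+m\phi^1,\,-i\partial\phi^1-m\phi^2)$ with weak derivative $\partial$, on the domain $\widetilde H^1=\bigoplus_{l=1}^N H^1((0,\infty);\mathbb C^2)$. Put $\Gamma^1\Phi=(\phi^1_{e_l}(0))_{l}$ and $\Gamma^2\Phi=(i\phi^2_{e_l}(0))_{l}$. Let $D^0$ and $D^{\Lambda_{A,B}}$ be the restrictions of $D^{max}$ to $\{\Phi\in\widetilde H^1:\Gamma^1\Phi=0\}$ and to $\{\Phi\in\widetilde H^1: A\Gamma^1\Phi=B\Gamma^2\Phi\}$, respectively. Let $\sigma$ denote the spectrum and $\sigma_p$ the point spectrum, i.e. the set of eigenvalues. Let $L(\lambda)=A-\lambda B$, $\lambda\in\mathbb C$,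 and $\sigma(A,B)=\{\lambda\in\mathbb C: 0\in\sigma(L(\lambda))\}$. Let $\mathbb C^\pm$ be the open upper and lower half-planes. For $z\in\mathbb C\setminus\sigma(D^0)$ put $\alpha(z)=k(z)/(z-m)$, where $k(z)=\sqrt{z^2-m^2}$ with $\arg k(z)\in[0,\pi)$. An eigenvalue $z\in\sigma_p(D^{\Lambda_{A,B}})\setminus\sigma(D^0)$ is said to correspond to $\lambda$ if $\lambda=i/\alpha(z)$. Then $\sigma(D^0)=(-\infty,-m]\cup[m,\infty)$, $\sigma(A,B)=\{\lambda:\det L(\lambda)=0\}$, and the following holds. (I) If $\det L(\lambda)=0$ for all $\lambda\in\mathbb C$, then $\sigma(D^{\Lambda_{A,B}})=\mathbb C$ and $\mathbb C\setminus\sigma(D^0)\subset\sigma_p(D^{\Lambda_{A,B}})$. (II) If $\det L(\lambda)\ne0$ for all $\lambda\in\mathbb C$, then no $z\in\mathbb C\setminus\sigma(D^0)$ belongs to $\sigma(D^{\Lambda_{A,B}})$. (III) Suppose that $\det L(\lambda)$ vanishes for some but not for all $\lambda\in\mathbb C$. Then $\sigma(A,B)$ is finite with at least $1$ and at most $N$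 elements, and: (i) If $m=0$ and $i\in\sigma(A,B)$, then $\mathbb C^+\subset\sigma_p(D^{\Lambda_{A,B}})$ and $\overline{\mathbb C^+}\subset\sigma(D^{\Lambda_{A,B}})$. If $m=0$ and $-i\in\sigma(A,B)$, then $\mathbb C^-\subset\sigma_p(D^{\Lambda_{A,B}})$ and $\overline{\mathbb C^-}\subset\sigma(D^{\Lambda_{A,B}})$. If $m>0$, no eigenvalue of $D^{\Lambda_{A,B}}$ corresponds to a point $\lambda=\pm i$ of $\sigma(A,B)$. (ii) If $\lambda\in\sigma(A,B)$, $\operatorname{Re}\lambda<0$ and $m>0$, then $$m\,\frac{1-\lambda^2}{1+\lambda^2}\in\sigma_p(D^{\Lambda_{A,B}}),$$ and this is the one and only eigenvalue corresponding to $\lambda$. For all other $\lambda\in\sigma(A,B)\setminus\{i,-i\}$ (that is, if $m=0$ or $\operatorname{Re}\lambda\ge0$), no eigenvalue of $D^{\Lambda_{A,B}}$ corresponds to $\lambda$. Moreover, every $z\in\sigma_p(D^{\Lambda_{A,B}})\setminus\sigma(D^0)$ corresponds to some $\lambda\in\sigma(A,B)$. Hence, if $m=0$, then $\sigma_p(D^{\Lambda_{A,B}})\setminus\sigma(D^0)$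 is the union of those of the half-planes $\mathbb C^\pm$ for which $\pm i\in\sigma(A,B)$. If $m>0$, then $$\sigma_p(D^{\Lambda_{A,B}})\setminus\sigma(D^0)=\Big\{m\,\frac{1-\lambda^2}{1+\lambda^2}:\ \lambda\in\sigma(A,B),\ \operatorname{Re}\lambda<0\Big\}.$$ -/

import Mathlib

open MeasureTheory Set
open scoped ContDiff

noncomputable section

namespace StarDirac

/-- `L²((0, ∞); ℂ)`. -/
abbrev HalfLineL2 : Type := Lp ℂ 2 (volume.restrict (Ioi (0 : ℝ)))

/-- `L²((0, ∞); ℂ²)`, written as the Hilbert sum of its two components: `φ 0` is the first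
component (`φ¹` in the usual notation) and `φ 1` the second one (`φ²`). -/
abbrev EdgeL2 : Type := PiLp 2 (fun _ : Fin 2 => HalfLineL2)

/-- The Hilbert space `L²(G; ℂ²)` of the star graph with `N` outgoing half-lines, each of them
parametrized by `(0, ∞)`: the Hilbert sum of the spaces of the edges. -/
abbrev StarL2 (N : ℕ) : Type := PiLp 2 (fun _ : Fin N => EdgeL2)

/-- `g` is the weak derivative of `u` on `(0, ∞)`. -/
def IsWeakDeriv (u g : HalfLineL2) : Prop :=
  ∀ η : ℝ → ℝ, ContDiff ℝ ∞ η → HasCompactSupport η → tsupport η ⊆ Ioi 0 →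
    ∫ x in Ioi (0 : ℝ), deriv η x • u x = - ∫ x in Ioi (0 : ℝ), η x • g x

lemma integrable_test_smul (u : HalfLineL2) {η : ℝ → ℝ} (hη : Continuous η)
    (hc : HasCompactSupport η) :
    Integrable (fun x => η x • u x) (volume.restrict (Ioi (0 : ℝ))) := by
  have h : LocallyIntegrable (fun x => u x) (volume.restrict (Ioi (0 : ℝ))) :=
    (Lp.memLp u).locallyIntegrable (by norm_num)
  exact h.integrable_smul_left_of_hasCompactSupport hη hc

lemma integrable_deriv_test_smul (u : HalfLineL2) {η : ℝ → ℝ} (hη : ContDiff ℝ ∞ η)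
    (hc : HasCompactSupport η) :
    Integrable (fun x => deriv η x • u x) (volume.restrict (Ioi (0 : ℝ))) :=
  integrable_test_smul u (hη.continuous_deriv (by simp)) hc.deriv

lemma IsWeakDeriv.add {u v g h : HalfLineL2} (hu : IsWeakDeriv u g) (hv : IsWeakDeriv v h) :
    IsWeakDeriv (u + v) (g + h) := by
  intro η hη hc hs
  have e1 : ∫ x in Ioi (0 : ℝ), deriv η x • (u + v : HalfLineL2) x =
      ∫ x in Ioi (0 : ℝ), (deriv η x • u x + deriv η x • v x) := by
    refine integral_congr_ae ?_
    filter_upwards [Lp.coeFn_add u v] with x hx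
    rw [hx, Pi.add_apply, smul_add]
  have e2 : ∫ x in Ioi (0 : ℝ), η x • (g + h : HalfLineL2) x =
      ∫ x in Ioi (0 : ℝ), (η x • g x + η x • h x) := by
    refine integral_congr_ae ?_
    filter_upwards [Lp.coeFn_add g h] with x hx
    rw [hx, Pi.add_apply, smul_add]
  rw [e1, e2, integral_add (integrable_deriv_test_smul u hη hc)
    (integrable_deriv_test_smul v hη hc), integral_add
    (integrable_test_smul g hη.continuous hc) (integrable_test_smul h hη.continuous hc),
    hu η hη hc hs, hv η hη hc hs, neg_add]

lemma IsWeakDeriv.smul {u g : HalfLineL2} (c : ℂ) (hu : IsWeakDeriv u g) :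
    IsWeakDeriv (c • u) (c • g) := by
  intro η hη hc hs
  have e1 : ∫ x in Ioi (0 : ℝ), deriv η x • (c • u : HalfLineL2) x =
      ∫ x in Ioi (0 : ℝ), c • (deriv η x • u x) := by
    refine integral_congr_ae ?_
    filter_upwards [Lp.coeFn_smul c u] with x hx
    rw [hx, Pi.smul_apply, smul_comm]
  have e2 : ∫ x in Ioi (0 : ℝ), η x • (c • g : HalfLineL2) x =
      ∫ x in Ioi (0 : ℝ), c • (η x • g x) := by
    refine integral_congr_ae ?_
    filter_upwards [Lp.coeFn_smul c g] with x hx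
    rw [hx, Pi.smul_apply, smul_comm]
  rw [e1, e2, integral_smul, integral_smul, hu η hη hc hs, smul_neg]

lemma IsWeakDeriv.unique {u g h : HalfLineL2} (hg : IsWeakDeriv u g) (hh : IsWeakDeriv u h) :
    g = h := by
  have key : ∀ᵐ x ∂(volume.restrict (Ioi (0 : ℝ))), x ∈ Ioi (0 : ℝ) → g x - h x = 0 := by
    refine isOpen_Ioi.ae_eq_zero_of_integral_contDiff_smul_eq_zero ?_ ?_
    · exact (((Lp.memLp g).locallyIntegrable (by norm_num)).sub
        ((Lp.memLp h).locallyIntegrable (by norm_num))).locallyIntegrableOn _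
    · intro η hη hc hs
      have := (hg η hη hc hs).symm.trans (hh η hη hc hs)
      simp only [smul_sub]
      rw [integral_sub (integrable_test_smul g hη.continuous hc)
        (integrable_test_smul h hη.continuous hc), neg_injective this, sub_self]
  refine Lp.ext ?_
  filter_upwards [key, ae_restrict_mem measurableSet_Ioi] with x hx hx0
  exact sub_eq_zero.mp (hx hx0)

/-- The Sobolev space `H¹((0, ∞); ℂ)`: square-integrable functions with a square-integrable weak
derivative. -/
def H1 : Submodule ℂ HalfLineL2 where
  carrier := {u | ∃ g : HalfLineL2, IsWeakDeriv u g}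
  add_mem' := by
    rintro u v ⟨g, hg⟩ ⟨h, hh⟩
    exact ⟨g + h, hg.add hh⟩
  zero_mem' := ⟨0, by simpa using IsWeakDeriv.smul (u := 0) (g := 0) 0 (by
    intro η _ _ _
    have h0 : ∀ f : ℝ → ℝ, ∫ x in Ioi (0 : ℝ), f x • (0 : HalfLineL2) x = 0 := by
      intro f
      refine integral_eq_zero_of_ae ?_
      filter_upwards [Lp.coeFn_zero ℂ 2 (volume.restrict (Ioi (0 : ℝ)))] with x hx
      rw [hx]
      simp
    rw [h0, h0, neg_zero])⟩
  smul_mem' := by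
    rintro c u ⟨g, hg⟩
    exact ⟨c • g, hg.smul c⟩

/-- The weak derivative `∂ : H¹((0, ∞); ℂ) → L²((0, ∞); ℂ)`. -/
def weakDeriv : H1 →ₗ[ℂ] HalfLineL2 where
  toFun u := u.2.choose
  map_add' u v := IsWeakDeriv.unique (u + v).2.choose_spec (u.2.choose_spec.add v.2.choose_spec)
  map_smul' c u := IsWeakDeriv.unique (c • u).2.choose_spec (u.2.choose_spec.smul c)

lemma isWeakDeriv_weakDeriv (u : H1) : IsWeakDeriv u (weakDeriv u) := u.2.choose_spec

/-- `c` is the boundary value `u(0)`: some representative of `u` is continuous on `[0, ∞)` and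
has the value `c` at `0`. (Such a representative is unique, and exists for every `u ∈ H¹`.) -/
def HasTrace (u : HalfLineL2) (c : ℂ) : Prop :=
  ∃ v : ℝ → ℂ, ContinuousOn v (Ici 0) ∧ u =ᵐ[volume.restrict (Ioi (0 : ℝ))] v ∧ v 0 = c

lemma HasTrace.add {u v : HalfLineL2} {c d : ℂ} (hu : HasTrace u c) (hv : HasTrace v d) :
    HasTrace (u + v) (c + d) := by
  obtain ⟨f, hf, hfu, rfl⟩ := hu
  obtain ⟨g, hg, hgv, rfl⟩ := hv
  exact ⟨f + g, hf.add hg, (Lp.coeFn_add u v).trans (hfu.add hgv), rfl⟩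

lemma HasTrace.smul {u : HalfLineL2} {c : ℂ} (a : ℂ) (hu : HasTrace u c) :
    HasTrace (a • u) (a • c) := by
  obtain ⟨f, hf, hfu, rfl⟩ := hu
  exact ⟨a • f, hf.const_smul a, (Lp.coeFn_smul a u).trans (hfu.const_smul a), rfl⟩

lemma hasTrace_zero : HasTrace 0 0 :=
  ⟨0, continuousOn_const, Lp.coeFn_zero ℂ 2 (volume.restrict (Ioi (0 : ℝ))), rfl⟩

lemma HasTrace.unique {u : HalfLineL2} {c d : ℂ} (hc : HasTrace u c) (hd : HasTrace u d) :
    c = d := by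
  obtain ⟨f, hf, hfu, rfl⟩ := hc
  obtain ⟨g, hg, hgu, rfl⟩ := hd
  have hae : f =ᵐ[volume.restrict (Ioi (0 : ℝ))] g := hfu.symm.trans hgu
  have hon : EqOn f g (Ioi 0) :=
    Measure.eqOn_open_of_ae_eq hae isOpen_Ioi (hf.mono Ioi_subset_Ici_self)
      (hg.mono Ioi_subset_Ici_self)
  exact hon.of_subset_closure hf hg Ioi_subset_Ici_self (by rw [closure_Ioi])
    (mem_Ici.mpr le_rfl)

variable {N : ℕ}

/-- The Sobolev space `H̃¹(G; ℂ²)`: all components on all edges belong to `H¹((0, ∞); ℂ)`. -/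
def starH1 (N : ℕ) : Submodule ℂ (StarL2 N) where
  carrier := {Φ | ∀ e j, Φ e j ∈ H1}
  add_mem' hΦ hΨ e j := H1.add_mem (hΦ e j) (hΨ e j)
  zero_mem' _ _ := H1.zero_mem
  smul_mem' c _ hΦ e j := H1.smul_mem c (hΦ e j)

/-- The weak derivative of the `j`-th component on the edge `e`. -/
def compDeriv (e : Fin N) (j : Fin 2) : starH1 N →ₗ[ℂ] HalfLineL2 where
  toFun Φ := weakDeriv ⟨(Φ : StarL2 N) e j, Φ.2 e j⟩
  map_add' Φ Ψ :=
    weakDeriv.map_add ⟨(Φ : StarL2 N) e j, Φ.2 e j⟩ ⟨(Ψ : StarL2 N) e j, Ψ.2 e j⟩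
  map_smul' c Φ := weakDeriv.map_smul c ⟨(Φ : StarL2 N) e j, Φ.2 e j⟩

/-- The maximal Dirac operator with mass `m`, acting as `-i ∂ ⊗ σ₁ + m ⊗ σ₃` on each edge, i.e.
`(φ¹, φ²) ↦ (-i ∂φ² + m φ¹, -i ∂φ¹ - m φ²)`, with the domain `H̃¹(G; ℂ²)`. -/
def diracMax (N : ℕ) (m : ℝ) : StarL2 N →ₗ.[ℂ] StarL2 N where
  domain := starH1 N
  toFun :=
    { toFun := fun Φ => WithLp.toLp 2 fun e => WithLp.toLp 2
        ![-Complex.I • compDeriv e 1 Φ + (m : ℂ) • (Φ : StarL2 N) e 0,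
          -Complex.I • compDeriv e 0 Φ - (m : ℂ) • (Φ : StarL2 N) e 1]
      map_add' := by
        intro Φ Ψ
        ext e j : 2
        fin_cases j
        · simp only [Fin.zero_eta, map_add, smul_add, Submodule.coe_add, PiLp.add_apply,
            Matrix.cons_val_zero]
          abel
        · simp only [Fin.mk_one, map_add, smul_add, Submodule.coe_add, PiLp.add_apply,
            Matrix.cons_val_one, Matrix.cons_val_zero]
          abel
      map_smul' := by
        intro c Φ
        ext e j : 2
        fin_cases j
        · simp only [Fin.zero_eta, map_smul, RingHom.id_apply, Submodule.coe_smul,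
            PiLp.smul_apply, Matrix.cons_val_zero, smul_add, smul_comm c]
        · simp only [Fin.mk_one, map_smul, RingHom.id_apply, Submodule.coe_smul,
            PiLp.smul_apply, Matrix.cons_val_one, Matrix.cons_val_zero, smul_sub, smul_comm c] }

/-- The boundary values of `Φ` are `Γ¹ Φ = f` and `Γ² Φ = f'`, where
`Γ¹ Φ = (φ¹_e(0))_e` and `Γ² Φ = (i φ²_e(0))_e`. -/
def HasBoundaryValues (Φ : StarL2 N) (f f' : Fin N → ℂ) : Prop :=
  ∀ e, HasTrace (Φ e 0) (f e) ∧ HasTrace (Complex.I • Φ e 1) (f' e)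

/-- The functions whose boundary values satisfy `(Γ¹ Φ, Γ² Φ) ∈ Λ`. -/
def boundaryCondition (L : Submodule ℂ ((Fin N → ℂ) × (Fin N → ℂ))) :
    Submodule ℂ (StarL2 N) where
  carrier := {Φ | ∃ f f' : Fin N → ℂ, HasBoundaryValues Φ f f' ∧ (f, f') ∈ L}
  add_mem' := by
    rintro Φ Ψ ⟨f, f', h, hL⟩ ⟨g, g', k, kL⟩
    refine ⟨f + g, f' + g', fun e => ⟨(h e).1.add (k e).1, ?_⟩, L.add_mem hL kL⟩
    rw [PiLp.add_apply, PiLp.add_apply, smul_add]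
    exact (h e).2.add (k e).2
  zero_mem' := ⟨0, 0, fun e => ⟨hasTrace_zero, by
    simpa using hasTrace_zero⟩, L.zero_mem⟩
  smul_mem' := by
    rintro c Φ ⟨f, f', h, hL⟩
    refine ⟨c • f, c • f', fun e => ⟨(h e).1.smul c, ?_⟩, L.smul_mem c hL⟩
    rw [PiLp.smul_apply, PiLp.smul_apply, smul_comm]
    exact (h e).2.smul c

/-- The Dirac operator `D^Λ` given by a linear relation `Λ` in `ℂ^N`: the restriction of the
maximal operator to `{Φ ∈ H̃¹ | (Γ¹ Φ, Γ² Φ) ∈ Λ}`. -/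
def dirac (m : ℝ) (L : Submodule ℂ ((Fin N → ℂ) × (Fin N → ℂ))) : StarL2 N →ₗ.[ℂ] StarL2 N :=
  (diracMax N m).domRestrict (boundaryCondition L)

/-- The linear relation `Λ_{A,B} = {(f, f') | A f = B f'}`. -/
def relation (A B : Matrix (Fin N) (Fin N) ℂ) : Submodule ℂ ((Fin N → ℂ) × (Fin N → ℂ)) where
  carrier := {p | A.mulVec p.1 = B.mulVec p.2}
  add_mem' := by
    intro p q hp hq
    simp only [mem_ofPred_eq] at hp hq ⊢
    rw [Prod.fst_add, Prod.snd_add, Matrix.mulVec_add, Matrix.mulVec_add, hp, hq]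
  zero_mem' := by simp
  smul_mem' := by
    intro c p hp
    simp only [mem_ofPred_eq] at hp ⊢
    rw [Prod.smul_fst, Prod.smul_snd, Matrix.mulVec_smul, Matrix.mulVec_smul, hp]

/-- The operator `D^{Λ_{A,B}}`, i.e. the Dirac operator with the vertex condition
`A Γ¹ Φ = B Γ² Φ`. -/
def diracAB (m : ℝ) (A B : Matrix (Fin N) (Fin N) ℂ) : StarL2 N →ₗ.[ℂ] StarL2 N :=
  dirac m (relation A B)

/-- The reference operator `D⁰`, the restriction of the maximal operator to `ker Γ¹`, i.e. the
operator given by the relation `{0} × ℂ^N`. -/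
def diracZero (N : ℕ) (m : ℝ) : StarL2 N →ₗ.[ℂ] StarL2 N :=
  dirac m (Submodule.prod ⊥ ⊤)

section Spectrum

variable {H : Type*} [NormedAddCommGroup H] [NormedSpace ℂ H]

/-- The resolvent set of an unbounded operator `T`: those `z` for which `T - z`, as a map from the
domain of `T` to the whole space, has an everywhere defined bounded inverse. -/
def resolventSet (T : H →ₗ.[ℂ] H) : Set ℂ :=
  {z | ∃ R : H →L[ℂ] H,
    (∀ y, ∃ x : T.domain, (x : H) = R y ∧ T x - z • (x : H) = y) ∧
    ∀ x : T.domain, R (T x - z • (x : H)) = x}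

/-- The spectrum of an unbounded operator. -/
def spec (T : H →ₗ.[ℂ] H) : Set ℂ := (resolventSet T)ᶜ

/-- The point spectrum of an unbounded operator, i.e. the set of its eigenvalues. -/
def pointSpec (T : H →ₗ.[ℂ] H) : Set ℂ :=
  {z | ∃ x : T.domain, (x : H) ≠ 0 ∧ T x = z • (x : H)}

end Spectrum

/-- The linear pencil `L(μ) = A - μ B`. -/
def pencil (A B : Matrix (Fin N) (Fin N) ℂ) (μ : ℂ) : Matrix (Fin N) (Fin N) ℂ := A - μ • B

/-- The spectrum `σ(A, B)` of the pencil: those `μ` with `0 ∈ σ(L(μ))`. -/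
def pencilSpec (A B : Matrix (Fin N) (Fin N) ℂ) : Set ℂ := {μ | 0 ∈ spectrum ℂ (pencil A B μ)}

/-- `k(z) = √(z² - m²)`, with the branch of the square root for which `arg k(z) ∈ [0, π)`. -/
def momentum (m : ℝ) (z : ℂ) : ℂ :=
  let w := (z ^ 2 - (m : ℂ) ^ 2) ^ (1 / 2 : ℂ)
  if 0 ≤ w.arg then w else -w

/-- `α(z) = k(z) / (z - m)`, which is also `(z + m) / k(z)`, for `z ≠ ±m`. -/
def alpha (m : ℝ) (z : ℂ) : ℂ := momentum m z / (z - m)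

/-- The eigenvalue `z` of `D^{Λ_{A,B}}`, off the spectrum of `D⁰`, corresponds to the point `μ`:
`μ = i / α(z)`. -/
def EigenvalueCorrespondsTo (m : ℝ) (A B : Matrix (Fin N) (Fin N) ℂ) (z μ : ℂ) : Prop :=
  z ∈ pointSpec (diracAB m A B) ∧ z ∉ spec (diracZero N m) ∧ μ = Complex.I / alpha m z

/-- The open upper half-plane `ℂ⁺`. -/
def upperHalf : Set ℂ := {z | 0 < z.im}

/-- The open lower half-plane `ℂ⁻`. -/
def lowerHalf : Set ℂ := {z | z.im < 0}

end StarDirac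

end

open StarDirac

/-!
Write `k = k(z)` and `α = α(z)`. Off `(-∞, -m] ∪ [m, ∞)` one has `Im k > 0`, `z + m = k α` and
`α (z - m) = k`, so that the combinations `u± = φ¹ ± α φ²` decouple the system `(D - z) Φ = F`
edge by edge into the scalar equations

`u₊' = i k u₊ + i (F² + α F¹)` and `u₋' = -i k u₋ + i (F² - α F¹)`.

Square-integrable weak solutions of `u' = c u` are multiples of `e^{cx}` if `Re c < 0` and vanish if
`Re c > 0` (`IsWeakDeriv.exists_ae_eq_exp`, by the lemma of du Bois-Reymond, and
`IsWeakDeriv.eq_zero_of_re_neg`). Hence the second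
equation has a single solution in `L²`, with a boundary value given by a bounded functional of the
data, and the first one has a solution for every boundary value; both are given by bounded operators,
namely convolutions with integrable kernels (`exists_convolution_operator`, a Schur test).

Inserting the boundary values into `A Γ¹ Φ = B Γ² Φ` leaves a linear system in `ℂ^N` with the matrix
`L(i / α)`. So `z` is an eigenvalue if `det L(i / α) = 0` (`mem_pointSpec_iff`), and it belongs
to the resolvent set otherwise (`mem_resolventSet_of_det_ne_zero`). The reference operator is the case
`A = 1`, `B = 0`, where `L = 1`; conversely, damped standing waves are approximate eigenfunctions
at real `z` with `|z| > m`, which determines its spectrum (`spec_diracZero`). Closedness of the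
spectrum (`isClosed_spec`) accounts for the boundary points.

It remains to solve `μ = i / α(z)` for `z`. For `m > 0` it gives `z = m (1 - μ²) / (1 + μ²)` and
`k = -2 i m (μ + μ⁻¹)⁻¹`, and `Im k > 0` means `Re μ < 0` (`notMem_and_eq_I_div_alpha_iff`); for
`m = 0` the function `α` is `1` on the upper and `-1` on the lower half-plane.
-/

noncomputable section

namespace StarDirac

/-! ### Convolution with an integrable kernel on the half-line -/

/-- Cauchy–Schwarz with respect to the weight `k`. -/
lemma sq_lintegral_mul_le {α : Type*} [MeasurableSpace α] (μ : Measure α) {k f : α → ENNReal}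
    (hk : AEMeasurable k μ) (hf : AEMeasurable f μ) :
    (∫⁻ y, k y * f y ∂μ) ^ 2 ≤ (∫⁻ y, k y ∂μ) * ∫⁻ y, k y * f y ^ 2 ∂μ := by
  have h := ENNReal.lintegral_mul_le_Lp_mul_Lq μ (p := 2) (q := 2)
    (Real.HolderConjugate.two_two) (f := fun y => k y ^ (1 / 2 : ℝ))
    (g := fun y => k y ^ (1 / 2 : ℝ) * f y) (hk.pow_const _) ((hk.pow_const _).mul hf)
  have hs : ∀ a : ENNReal, a ^ (1 / 2 : ℝ) * a ^ (1 / 2 : ℝ) = a := by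
    intro a
    rw [← ENNReal.rpow_add_of_nonneg _ _ (by norm_num) (by norm_num)]
    norm_num
  have hs2 : ∀ a : ENNReal, (a ^ (1 / 2 : ℝ)) ^ 2 = a := fun a => by rw [sq, hs]
  have e1 : ∀ y, (fun y => k y ^ (1 / 2 : ℝ)) y * (k y ^ (1 / 2 : ℝ) * f y) = k y * f y := by
    intro y
    rw [← mul_assoc]
    simp only [hs]
  simp only [Pi.mul_apply, e1, ENNReal.rpow_ofNat, mul_pow, hs2] at h
  calc _ ≤ _ := pow_le_pow_left₀ zero_le h 2
    _ = _ := by rw [mul_pow, hs2, hs2]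

/-- Convolution with an integrable kernel, on the half-line, is a bounded operator on `L²`. -/
theorem exists_convolution_operator {κ : ℝ → ℂ} (hm : Measurable κ) (hκ : Integrable κ) :
    ∃ T : HalfLineL2 →L[ℂ] HalfLineL2, ∀ g : HalfLineL2,
      T g =ᵐ[volume.restrict (Ioi (0 : ℝ))] fun x => ∫ y in Ioi (0 : ℝ), κ (x - y) * g y := by
  set μ := volume.restrict (Ioi (0 : ℝ)) with hμ
  set C : ENNReal := ∫⁻ s, ‖κ s‖ₑ with hC
  have hCfin : C ≠ ⊤ := hκ.2.ne
  have hKm : Measurable fun p : ℝ × ℝ => κ (p.1 - p.2) :=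
    hm.comp (measurable_fst.sub measurable_snd)
  have hC1 : ∀ x, ∫⁻ y, ‖κ (x - y)‖ₑ ∂μ ≤ C := fun x =>
    (setLIntegral_le_lintegral _ _).trans
      (lintegral_sub_left_eq_self (fun s => ‖κ s‖ₑ) x).le
  have hC2 : ∀ y, ∫⁻ x, ‖κ (x - y)‖ₑ ∂μ ≤ C := fun y =>
    (setLIntegral_le_lintegral _ _).trans
      (lintegral_sub_right_eq_self (fun s => ‖κ s‖ₑ) y).le
  have hgm : ∀ g : HalfLineL2, Measurable fun y => ‖g y‖ₑ := fun g =>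
    (Lp.stronglyMeasurable g).measurable.enorm
  have hle : ∀ g : HalfLineL2, ∫⁻ x, (∫⁻ y, ‖κ (x - y)‖ₑ * ‖g y‖ₑ ∂μ) ^ 2 ∂μ ≤
      C ^ 2 * ∫⁻ y, ‖g y‖ₑ ^ 2 ∂μ := by
    intro g
    have hx : ∀ x, Measurable fun y => ‖κ (x - y)‖ₑ := fun x =>
      (hm.comp (measurable_const.sub measurable_id)).enorm
    calc ∫⁻ x, (∫⁻ y, ‖κ (x - y)‖ₑ * ‖g y‖ₑ ∂μ) ^ 2 ∂μ
        ≤ ∫⁻ x, C * ∫⁻ y, ‖κ (x - y)‖ₑ * ‖g y‖ₑ ^ 2 ∂μ ∂μ := by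
          refine lintegral_mono fun x => ?_
          refine (sq_lintegral_mul_le μ (hx x).aemeasurable (hgm g).aemeasurable).trans ?_
          gcongr
          exact hC1 x
      _ = C * ∫⁻ y, ∫⁻ x, ‖κ (x - y)‖ₑ * ‖g y‖ₑ ^ 2 ∂μ ∂μ := by
          rw [lintegral_const_mul' _ _ hCfin, lintegral_lintegral_swap]
          exact (hKm.enorm.mul (((hgm g).comp measurable_snd).pow_const 2)).aemeasurable
      _ ≤ C * ∫⁻ y, C * ‖g y‖ₑ ^ 2 ∂μ := by
          gcongr with y
          rw [lintegral_mul_const' _ _ (ENNReal.pow_ne_top enorm_ne_top)]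
          gcongr
          exact hC2 y
      _ = C ^ 2 * ∫⁻ y, ‖g y‖ₑ ^ 2 ∂μ := by
          rw [lintegral_const_mul' _ _ hCfin]
          ring
  have hg2 : ∀ g : HalfLineL2, ∫⁻ y, ‖g y‖ₑ ^ 2 ∂μ = ‖g‖ₑ ^ 2 := by
    intro g
    rw [Lp.enorm_def, eLpNorm_eq_lintegral_rpow_enorm_toReal (by norm_num) (by norm_num)]
    simp only [ENNReal.toReal_ofNat, ENNReal.rpow_ofNat]
    rw [← ENNReal.rpow_natCast, ← ENNReal.rpow_mul, hμ]
    norm_num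
  have hint : ∀ g : HalfLineL2, ∀ᵐ x ∂μ, Integrable (fun y => κ (x - y) * g y) μ := by
    intro g
    have hfin : ∫⁻ x, (∫⁻ y, ‖κ (x - y)‖ₑ * ‖g y‖ₑ ∂μ) ^ 2 ∂μ ≠ ⊤ := by
      refine ne_top_of_le_ne_top ?_ (hle g)
      rw [hg2]
      exact ENNReal.mul_ne_top (ENNReal.pow_ne_top hCfin) (ENNReal.pow_ne_top enorm_ne_top)
    have hmeas : Measurable fun x => ∫⁻ y, ‖κ (x - y)‖ₑ * ‖g y‖ₑ ∂μ :=
      (hKm.enorm.mul ((hgm g).comp measurable_snd)).lintegral_prod_right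
    filter_upwards [ae_lt_top (hmeas.pow_const 2) hfin] with x hx
    refine ⟨((hm.comp (measurable_const.sub measurable_id)).mul
      (Lp.stronglyMeasurable g).measurable).aestronglyMeasurable, ?_⟩
    rw [HasFiniteIntegral]
    simp only [enorm_mul]
    exact (ENNReal.pow_lt_top_iff.mp hx).resolve_right (by norm_num)
  have hnorm : ∀ g : HalfLineL2, eLpNorm (fun x => ∫ y, κ (x - y) * g y ∂μ) 2 μ ≤ C * ‖g‖ₑ := by
    intro g
    rw [eLpNorm_eq_lintegral_rpow_enorm_toReal (by norm_num) (by norm_num)]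
    simp only [ENNReal.toReal_ofNat, ENNReal.rpow_ofNat]
    have h1 : ∫⁻ x, ‖∫ y, κ (x - y) * g y ∂μ‖ₑ ^ 2 ∂μ ≤ (C * ‖g‖ₑ) ^ 2 := by
      rw [mul_pow, ← hg2]
      refine le_trans (lintegral_mono fun x => ?_) (hle g)
      refine pow_le_pow_left₀ zero_le ((enorm_integral_le_lintegral_enorm _).trans ?_) 2
      simp only [enorm_mul, le_refl]
    calc _ ≤ ((C * ‖g‖ₑ) ^ 2) ^ (1 / 2 : ℝ) := ENNReal.rpow_le_rpow h1 (by norm_num)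
      _ = C * ‖g‖ₑ := by
        rw [← ENNReal.rpow_natCast, ← ENNReal.rpow_mul]
        norm_num
  have hmem : ∀ g : HalfLineL2, MemLp (fun x => ∫ y, κ (x - y) * g y ∂μ) 2 μ := by
    intro g
    refine ⟨?_, (hnorm g).trans_lt (ENNReal.mul_lt_top hCfin.lt_top enorm_lt_top)⟩
    exact ((hKm.mul ((Lp.stronglyMeasurable g).measurable.comp
      measurable_snd)).stronglyMeasurable.integral_prod_right).aestronglyMeasurable
  let T₀ : HalfLineL2 →ₗ[ℂ] HalfLineL2 :=
    { toFun := fun g => (hmem g).toLp _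
      map_add' := by
        intro g h
        rw [← MemLp.toLp_add, MemLp.toLp_eq_toLp_iff]
        filter_upwards [hint g, hint h] with x hgx hhx
        rw [Pi.add_apply, ← integral_add hgx hhx]
        refine integral_congr_ae ?_
        filter_upwards [Lp.coeFn_add g h] with y hy
        rw [hy, Pi.add_apply, mul_add]
      map_smul' := by
        intro c g
        rw [RingHom.id_apply, ← MemLp.toLp_const_smul, MemLp.toLp_eq_toLp_iff]
        refine Filter.Eventually.of_forall fun x => ?_
        rw [Pi.smul_apply, ← integral_smul]
        refine integral_congr_ae ?_
        filter_upwards [Lp.coeFn_smul c g] with y hy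
        rw [hy, Pi.smul_apply, smul_eq_mul, smul_eq_mul, mul_left_comm] }
  refine ⟨T₀.mkContinuous C.toReal fun g => ?_, fun g => (hmem g).coeFn_toLp⟩
  change ‖(hmem g).toLp _‖ ≤ _
  rw [Lp.norm_toLp]
  refine (ENNReal.toReal_mono (ENNReal.mul_ne_top hCfin enorm_ne_top) (hnorm g)).trans ?_
  rw [ENNReal.toReal_mul, toReal_enorm]

/-! ### Variation of constants for weak derivatives -/

lemma intervalIntegrable_of_halfLineL2 (g : HalfLineL2) {f : ℝ → ℂ} (hf : Continuous f)
    {x : ℝ} (hx : 0 ≤ x) : IntervalIntegrable (fun t => f t * g t) volume 0 x := by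
  rw [intervalIntegrable_iff_integrableOn_Ioc_of_le hx]
  have h1 : IntegrableOn (fun t => g t) (Ioc 0 x) := by
    have h2 : MemLp (fun t => g t) 2 (volume.restrict (Ioc 0 x)) :=
      (Lp.memLp g).mono_measure (Measure.restrict_mono Ioc_subset_Ioi_self le_rfl)
    exact h2.integrable (by norm_num)
  have h3 : IntegrableOn (fun t => f t * g t) (Icc 0 x) :=
    IntegrableOn.continuousOn_mul hf.continuousOn
      ((integrableOn_Icc_iff_integrableOn_Ioc).mpr h1) isCompact_Icc
  exact h3.mono_set Ioc_subset_Icc_self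

/-- Integration by parts against a primitive of a merely integrable function. -/
lemma integral_deriv_mul_primitive {θ θ' w : ℝ → ℂ} {R : ℝ} (hR : 0 ≤ R)
    (hd : ∀ x, HasDerivAt θ (θ' x) x) (hc : Continuous θ') (h0 : θ 0 = 0) (hθR : θ R = 0)
    (hw : IntervalIntegrable w volume 0 R) (C : ℂ) :
    ∫ x in 0..R, θ' x * (C + ∫ t in 0..x, w t) = -∫ t in 0..R, θ t * w t := by
  have hwi : Integrable w (volume.restrict (Ioc 0 R)) :=
    (intervalIntegrable_iff_integrableOn_Ioc_of_le hR).mp hw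
  have hθi : Integrable θ' (volume.restrict (Ioc 0 R)) :=
    (intervalIntegrable_iff_integrableOn_Ioc_of_le hR).mp (hc.intervalIntegrable 0 R)
  have hCz : ∫ x in 0..R, θ' x * C = 0 := by
    rw [intervalIntegral.integral_mul_const, intervalIntegral.integral_eq_sub_of_hasDerivAt
      (fun x _ => hd x) (hc.intervalIntegrable _ _), h0, hθR, sub_zero, zero_mul]
  have hprod : Integrable (fun p : ℝ × ℝ => {p : ℝ × ℝ | p.2 ≤ p.1}.indicator
      (fun p => θ' p.1 * w p.2) p) ((volume.restrict (Ioc 0 R)).prod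
        (volume.restrict (Ioc 0 R))) :=
    (hθi.mul_prod hwi).indicator (measurableSet_le measurable_snd measurable_fst)
  -- Fubini on the triangle `t ≤ x`
  have hswap := integral_integral_swap (f := fun x t => {p : ℝ × ℝ | p.2 ≤ p.1}.indicator
    (fun p => θ' p.1 * w p.2) (x, t)) hprod
  have hL : ∀ x ∈ Ioc 0 R, ∫ t in Ioc 0 R, {p : ℝ × ℝ | p.2 ≤ p.1}.indicator
      (fun p => θ' p.1 * w p.2) (x, t) = θ' x * ∫ t in 0..x, w t := by
    intro x hx
    have e : (fun t => {p : ℝ × ℝ | p.2 ≤ p.1}.indicator (fun p => θ' p.1 * w p.2) (x, t)) =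
        (Iic x).indicator fun t => θ' x * w t := by
      ext t
      simp only [indicator, mem_ofPred_eq, mem_Iic]
    rw [e, setIntegral_indicator measurableSet_Iic, Ioc_inter_Iic, min_eq_right hx.2,
      integral_const_mul, intervalIntegral.integral_of_le hx.1.le]
  have hRt : ∀ t ∈ Ioc 0 R, ∫ x in Ioc 0 R, {p : ℝ × ℝ | p.2 ≤ p.1}.indicator
      (fun p => θ' p.1 * w p.2) (x, t) = -(θ t * w t) := by
    intro t ht
    have e : (fun x => {p : ℝ × ℝ | p.2 ≤ p.1}.indicator (fun p => θ' p.1 * w p.2) (x, t)) =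
        (Ici t).indicator fun x => θ' x * w t := by
      ext x
      simp only [indicator, mem_ofPred_eq, mem_Ici]
    have hset : Ioc 0 R ∩ Ici t = Icc t R := by
      ext x
      simp only [mem_inter_iff, mem_Ioc, mem_Ici, mem_Icc]
      exact ⟨fun h => ⟨h.2, h.1.2⟩, fun h => ⟨⟨ht.1.trans_le h.1, h.2⟩, h.1⟩⟩
    rw [e, setIntegral_indicator measurableSet_Ici, hset, integral_Icc_eq_integral_Ioc,
      ← intervalIntegral.integral_of_le ht.2, intervalIntegral.integral_mul_const,
      intervalIntegral.integral_eq_sub_of_hasDerivAt (fun x _ => hd x)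
        (hc.intervalIntegrable _ _), hθR, zero_sub, neg_mul]
  rw [setIntegral_congr_fun measurableSet_Ioc hL, setIntegral_congr_fun measurableSet_Ioc hRt,
    ← intervalIntegral.integral_of_le hR, integral_neg,
    ← intervalIntegral.integral_of_le hR] at hswap
  have hcont : ContinuousOn (fun x => ∫ t in 0..x, w t) (uIcc 0 R) :=
    intervalIntegral.continuousOn_primitive_interval' hw left_mem_uIcc
  simp only [mul_add]
  have i1 : IntervalIntegrable (fun x => θ' x * C) volume 0 R :=
    (hc.mul continuous_const).intervalIntegrable _ _
  have i2 : IntervalIntegrable (fun x => θ' x * ∫ t in 0..x, w t) volume 0 R :=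
    (hc.continuousOn.mul hcont).intervalIntegrable
  rw [intervalIntegral.integral_add i1 i2, hCz, zero_add, hswap]

/-- A function with compact support in `(0, ∞)` vanishes at `0` and beyond some point. -/
lemma exists_Ioo_of_tsupport_subset {E : Type*} [Zero E] {η : ℝ → E} (hc : HasCompactSupport η)
    (hs : tsupport η ⊆ Ioi 0) :
    ∃ a R : ℝ, 0 < a ∧ a ≤ R ∧ (∀ x ≤ a, η x = 0) ∧ ∀ x, R ≤ x → η x = 0 := by
  obtain ⟨R, hR⟩ := hc.isCompact.isBounded.bddAbove
  obtain ⟨a, ha0, ha⟩ : ∃ a : ℝ, 0 < a ∧ ∀ x ∈ tsupport η, a < x := by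
    rcases (tsupport η).eq_empty_or_nonempty with h | h
    · exact ⟨1, one_pos, fun x hx => absurd hx (by simp [h])⟩
    · obtain ⟨b, hb, hb'⟩ := hc.isCompact.exists_isLeast h
      have hb0 : 0 < b := hs hb
      exact ⟨b / 2, by linarith, fun x hx => by linarith [hb' hx]⟩
  refine ⟨a, max a (R + 1), ha0, le_max_left _ _, fun x hx => ?_, fun x hx => ?_⟩
  · exact image_eq_zero_of_notMem_tsupport fun h => absurd (ha x h) (not_lt.mpr hx)
  · refine image_eq_zero_of_notMem_tsupport fun h => ?_
    have := hR h
    linarith [le_max_right a (R + 1)]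

/-- Variation of constants: the functions `e^{cx} (C + ∫₀ˣ e^{-ct} g(t) dt)` solve
`u' = c u + g` with `u(0) = C`. -/
theorem isWeakDeriv_variation_of_constants {u g : HalfLineL2} {c C : ℂ}
    (hu : u =ᵐ[volume.restrict (Ioi (0 : ℝ))]
      fun x => Complex.exp (c * x) * (C + ∫ t in 0..x, Complex.exp (-(c * t)) * g t)) :
    IsWeakDeriv u (c • u + g) ∧ HasTrace u C := by
  have hexp : ∀ b : ℂ, Continuous fun x : ℝ => Complex.exp (b * x) := fun b => by fun_prop
  have hexpn : Continuous fun x : ℝ => Complex.exp (-(c * x)) := by fun_prop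
  constructor
  · intro η hη hcs hs
    obtain ⟨a, R, ha, haR, hηa, hηR⟩ := exists_Ioo_of_tsupport_subset hcs hs
    have hR : 0 ≤ R := ha.le.trans haR
    have hηd : ∀ x, HasDerivAt η (deriv η x) x := fun x =>
      (hη.differentiable (by simp) x).hasDerivAt
    have hηc : Continuous (deriv η) := hη.continuous_deriv (by simp)
    have hηR' : ∀ x, R < x → deriv η x = 0 := by
      intro x hx
      have : η =ᶠ[nhds x] fun _ => 0 := by
        filter_upwards [lt_mem_nhds hx] with y hy using hηR y hy.le
      rw [this.deriv_eq, deriv_const]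
    set W : ℝ → ℂ := fun x => C + ∫ t in 0..x, Complex.exp (-(c * t)) * g t with hW
    have hparts := integral_deriv_mul_primitive (θ := fun x => (η x : ℂ) * Complex.exp (c * x))
      (θ' := fun x => ((deriv η x : ℝ) : ℂ) * Complex.exp (c * x) +
        (η x : ℂ) * (Complex.exp (c * x) * c))
      (w := fun t => Complex.exp (-(c * t)) * g t) hR
      (fun x => by
        have h1 : HasDerivAt (fun x : ℝ => Complex.exp (c * x)) (Complex.exp (c * x) * c) x := by
          have := ((hasDerivAt_id x).ofReal_comp.const_mul c).cexp
          simpa using this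
        exact (hηd x).ofReal_comp.mul h1)
      (((Complex.continuous_ofReal.comp hηc).mul (hexp c)).add
        ((Complex.continuous_ofReal.comp hη.continuous).mul ((hexp c).mul continuous_const)))
      (by simp [hηa 0 ha.le]) (by simp [hηR R le_rfl])
      (intervalIntegrable_of_halfLineL2 g hexpn hR) C
    have hred : ∀ f : ℝ → ℂ, (∀ x, R < x → f x = 0) →
        ∫ x in Ioi (0 : ℝ), f x = ∫ x in 0..R, f x := by
      intro f hf
      rw [intervalIntegral.integral_of_le hR]
      refine setIntegral_eq_of_subset_of_forall_sdiff_eq_zero measurableSet_Ioi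
        Ioc_subset_Ioi_self fun x hx => hf x ?_
      by_contra h
      exact hx.2 ⟨hx.1, not_lt.mp h⟩
    have hWc : ContinuousOn W (uIcc 0 R) := by
      refine continuousOn_const.add ?_
      exact intervalIntegral.continuousOn_primitive_interval'
        (intervalIntegrable_of_halfLineL2 g hexpn hR) left_mem_uIcc
    have e1 : ∫ x in Ioi (0 : ℝ), deriv η x • u x =
        ∫ x in 0..R, ((deriv η x : ℝ) : ℂ) * Complex.exp (c * x) * W x := by
      rw [← hred _ fun x hx => by simp [hηR' x hx]]
      refine integral_congr_ae ?_
      filter_upwards [hu] with x hx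
      rw [hx, Complex.real_smul, mul_assoc]
    have e2 : ∫ x in Ioi (0 : ℝ), η x • (c • u + g : HalfLineL2) x =
        ∫ x in 0..R, ((η x : ℂ) * (Complex.exp (c * x) * c) * W x + (η x : ℂ) * g x) := by
      rw [← hred _ fun x hx => by simp [hηR x hx.le]]
      refine integral_congr_ae ?_
      filter_upwards [hu, Lp.coeFn_add (c • u) g, Lp.coeFn_smul c u] with x hx h1 h2
      rw [h1, Pi.add_apply, h2, Pi.smul_apply, hx, Complex.real_smul, smul_eq_mul]
      ring
    have e3 : ∀ t : ℝ, (η t : ℂ) * Complex.exp (c * t) * (Complex.exp (-(c * t)) * g t) =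
        (η t : ℂ) * g t := by
      intro t
      rw [mul_assoc, ← mul_assoc (Complex.exp _), ← Complex.exp_add, add_neg_cancel,
        Complex.exp_zero, one_mul]
    simp only [e3, add_mul] at hparts
    have i1 : IntervalIntegrable (fun x : ℝ => ((deriv η x : ℝ) : ℂ) * Complex.exp (c * x) * W x)
        volume 0 R := by
      refine ContinuousOn.intervalIntegrable (ContinuousOn.mul ?_ hWc)
      exact ((Complex.continuous_ofReal.comp hηc).mul (hexp c)).continuousOn
    have i2 : IntervalIntegrable (fun x : ℝ => (η x : ℂ) * (Complex.exp (c * x) * c) * W x)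
        volume 0 R := by
      refine ContinuousOn.intervalIntegrable (ContinuousOn.mul ?_ hWc)
      exact ((Complex.continuous_ofReal.comp hη.continuous).mul
        ((hexp c).mul continuous_const)).continuousOn
    have i3 : IntervalIntegrable (fun x : ℝ => (η x : ℂ) * g x) volume 0 R :=
      intervalIntegrable_of_halfLineL2 g (Complex.continuous_ofReal.comp hη.continuous) hR
    rw [intervalIntegral.integral_add i1 i2] at hparts
    rw [e1, e2, intervalIntegral.integral_add i2 i3]
    linear_combination hparts
  · refine ⟨_, ?_, hu, by simp⟩
    refine (hexp c).continuousOn.mul (continuousOn_const.add fun x hx => ?_)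
    have hx0 : (0 : ℝ) ≤ x := hx
    have h := intervalIntegral.continuousOn_primitive_interval'
      (intervalIntegrable_of_halfLineL2 g hexpn (by linarith : (0 : ℝ) ≤ x + 1)) left_mem_uIcc
    rw [uIcc_of_le (by linarith)] at h
    refine (h x ⟨hx0, by linarith⟩).mono_of_mem_nhdsWithin ?_
    refine mem_nhdsWithin.mpr ⟨Iio (x + 1), isOpen_Iio, by simp, fun y hy => ⟨hy.2, hy.1.le⟩⟩

/-! ### Uniqueness of weak solutions -/

/-- The lemma of du Bois-Reymond on the half-line. -/
lemma exists_ae_eq_const_of_integral_deriv_smul_eq_zero {v : ℝ → ℂ}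
    (hv : LocallyIntegrable v (volume.restrict (Ioi (0 : ℝ))))
    (h : ∀ η : ℝ → ℝ, ContDiff ℝ ∞ η → HasCompactSupport η → tsupport η ⊆ Ioi 0 →
      ∫ x in Ioi (0 : ℝ), deriv η x • v x = 0) :
    ∃ a : ℂ, ∀ᵐ x ∂(volume.restrict (Ioi (0 : ℝ))), v x = a := by
  have hI : ∀ {ψ : ℝ → ℝ}, Continuous ψ → HasCompactSupport ψ →
      Integrable (fun x => ψ x • v x) (volume.restrict (Ioi (0 : ℝ))) := fun hψ hc =>
    hv.integrable_smul_left_of_hasCompactSupport hψ hc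
  -- a test function supported in `[1, 3]` with integral one
  let b : ContDiffBump (2 : ℝ) := ⟨1 / 2, 1, by norm_num, by norm_num⟩
  set η₀ : ℝ → ℝ := b.normed volume with hη₀
  have hη₀c : ContDiff ℝ ∞ η₀ := b.contDiff_normed
  have hη₀s : HasCompactSupport η₀ := b.hasCompactSupport_normed
  have hη₀t : tsupport η₀ ⊆ Ioi 0 := by
    rw [hη₀, b.tsupport_normed_eq]
    intro x hx
    have : |x - 2| ≤ 1 := by simpa [Real.dist_eq, b] using hx
    rw [mem_Ioi]
    linarith [(abs_le.mp this).1]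
  have hη₀i : ∫ x, η₀ x = 1 := b.integral_normed
  set a : ℂ := ∫ x in Ioi (0 : ℝ), η₀ x • v x with ha
  refine ⟨a, ?_⟩
  have key : ∀ᵐ x ∂(volume.restrict (Ioi (0 : ℝ))), x ∈ Ioi (0 : ℝ) → v x - a = 0 := by
    refine isOpen_Ioi.ae_eq_zero_of_integral_contDiff_smul_eq_zero ?_ ?_
    · exact (hv.sub (locallyIntegrable_const a)).locallyIntegrableOn _
    · intro ψ hψ hψs hψt
      set J : ℝ := ∫ x, ψ x with hJ
      -- `ψ - J η₀` has integral zero, so it is the derivative of a test function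
      set ζ : ℝ → ℝ := fun x => ψ x - J * η₀ x with hζ
      have hζc : ContDiff ℝ ∞ ζ := hψ.sub (contDiff_const.mul hη₀c)
      have hψi : Integrable ψ := hψ.continuous.integrable_of_hasCompactSupport hψs
      have hη₀i' : Integrable η₀ := hη₀c.continuous.integrable_of_hasCompactSupport hη₀s
      have hζi : ∫ x, ζ x = 0 := by
        rw [hζ, integral_sub hψi (hη₀i'.const_mul J), integral_const_mul, hη₀i, mul_one, sub_self]
      obtain ⟨a₁, R₁, ha₁, -, hl₁, hr₁⟩ := exists_Ioo_of_tsupport_subset hψs hψt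
      obtain ⟨a₂, R₂, ha₂, -, hl₂, hr₂⟩ := exists_Ioo_of_tsupport_subset hη₀s hη₀t
      set l := min a₁ a₂ with hl
      set r := max R₁ R₂ with hr
      have hl0 : 0 < l := lt_min ha₁ ha₂
      have hζl : ∀ x ≤ l, ζ x = 0 := fun x hx => by
        simp [hζ, hl₁ x (hx.trans (min_le_left _ _)), hl₂ x (hx.trans (min_le_right _ _))]
      have hζr : ∀ x, r ≤ x → ζ x = 0 := fun x hx => by
        simp [hζ, hr₁ x ((le_max_left _ _).trans hx), hr₂ x ((le_max_right _ _).trans hx)]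
      set η : ℝ → ℝ := fun x => ∫ t in 0..x, ζ t with hη
      have hηd : ∀ x, HasDerivAt η (ζ x) x := fun x =>
        intervalIntegral.integral_hasDerivAt_right (hζc.continuous.intervalIntegrable _ _)
          (hζc.continuous.stronglyMeasurableAtFilter _ _) hζc.continuous.continuousAt
      have hderiv : deriv η = ζ := funext fun x => (hηd x).deriv
      have hηc : ContDiff ℝ ∞ η := by
        rw [contDiff_infty_iff_deriv, hderiv]
        exact ⟨fun x => (hηd x).differentiableAt, hζc⟩
      have hηl : ∀ x ≤ l, η x = 0 := by
        intro x hx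
        refine (intervalIntegral.integral_congr (g := fun _ => 0) fun t ht => ?_).trans (by simp)
        refine hζl t ?_
        rcases mem_uIcc.mp ht with h' | h' <;> linarith [h'.1, h'.2]
      have hηr : ∀ x, r ≤ x → η x = 0 := by
        intro x hx
        rcases le_total x 0 with h0 | h0
        · exact hηl x (h0.trans hl0.le)
        · rw [hη]
          dsimp only
          rw [intervalIntegral.integral_of_le h0]
          refine (setIntegral_eq_integral_of_forall_compl_eq_zero fun t ht => ?_).trans hζi
          by_cases h1 : 0 < t
          · refine hζr t (hx.trans ?_)
            by_contra h2
            exact ht ⟨h1, (not_le.mp h2).le⟩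
          · exact hζl t ((not_lt.mp h1).trans hl0.le)
      have hsub : tsupport η ⊆ Icc l r := by
        refine closure_minimal (fun x hx => ?_) isClosed_Icc
        refine ⟨?_, ?_⟩
        · by_contra h'
          exact hx (hηl x (not_le.mp h').le)
        · by_contra h'
          exact hx (hηr x (not_le.mp h').le)
      have hz := h η hηc (isCompact_Icc.of_isClosed_subset (isClosed_tsupport _) hsub)
        (hsub.trans fun x hx => hl0.trans_le hx.1)
      rw [hderiv] at hz
      simp only [hζ, sub_smul, mul_smul] at hz
      have hψa : ∫ x in Ioi (0 : ℝ), ψ x • a = J • a := by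
        rw [integral_smul_const, setIntegral_eq_integral_of_forall_compl_eq_zero]
        intro x hx
        exact hl₁ x ((not_lt.mp hx).trans ha₁.le)
      have i₀ : Integrable (fun x => J • η₀ x • v x) (volume.restrict (Ioi (0 : ℝ))) :=
        (hI hη₀c.continuous hη₀s).smul J
      rw [integral_sub (hI hψ.continuous hψs) i₀, integral_smul, ← ha] at hz
      simp only [smul_sub]
      rw [integral_sub (hI hψ.continuous hψs), hψa, hz]
      exact (locallyIntegrable_const a).integrable_smul_left_of_hasCompactSupport
        hψ.continuous hψs
  filter_upwards [key, ae_restrict_mem measurableSet_Ioi] with x hx hx0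
  exact sub_eq_zero.mp (hx hx0)

/-- A weak derivative may be tested against complex-valued functions. -/
lemma IsWeakDeriv.integral_complex_test {u g : HalfLineL2} (h : IsWeakDeriv u g) {θ : ℝ → ℂ}
    (hθ : ContDiff ℝ ∞ θ) (hc : HasCompactSupport θ) (hs : tsupport θ ⊆ Ioi 0) :
    ∫ x in Ioi (0 : ℝ), deriv θ x * u x = -∫ x in Ioi (0 : ℝ), θ x * g x := by
  have hd : ∀ x, HasDerivAt θ (deriv θ x) x := fun x =>
    (hθ.differentiable (by simp) x).hasDerivAt
  have hre : ContDiff ℝ ∞ fun x => (θ x).re := Complex.reCLM.contDiff.comp hθ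
  have him : ContDiff ℝ ∞ fun x => (θ x).im := Complex.imCLM.contDiff.comp hθ
  have hrec : HasCompactSupport fun x => (θ x).re := hc.comp_left (g := Complex.re) rfl
  have himc : HasCompactSupport fun x => (θ x).im := hc.comp_left (g := Complex.im) rfl
  have hres : tsupport (fun x => (θ x).re) ⊆ Ioi 0 :=
    (tsupport_comp_subset (g := Complex.re) rfl θ).trans hs
  have hims : tsupport (fun x => (θ x).im) ⊆ Ioi 0 :=
    (tsupport_comp_subset (g := Complex.im) rfl θ).trans hs
  have h1 := h _ hre hrec hres
  have h2 := h _ him himc hims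
  have hdre : deriv (fun x => (θ x).re) = fun x => (deriv θ x).re := funext fun x =>
    (Complex.reCLM.hasFDerivAt.comp_hasDerivAt x (hd x)).deriv
  have hdim : deriv (fun x => (θ x).im) = fun x => (deriv θ x).im := funext fun x =>
    (Complex.imCLM.hasFDerivAt.comp_hasDerivAt x (hd x)).deriv
  have i1 := integrable_deriv_test_smul u hre hrec
  have i2 := integrable_deriv_test_smul u him himc
  have i3 := integrable_test_smul g hre.continuous hrec
  have i4 := integrable_test_smul g him.continuous himc
  rw [hdre] at h1 i1
  rw [hdim] at h2 i2
  have e : ∀ z w : ℂ, z * w = z.re • w + Complex.I * (z.im • w) := by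
    intro z w
    rw [Complex.real_smul, Complex.real_smul]
    linear_combination -w * Complex.re_add_im z
  simp only [e (deriv θ _), e (θ _)]
  rw [integral_add i1 (i2.const_mul _), integral_add i3 (i4.const_mul _),
    integral_const_mul, integral_const_mul, h1, h2]
  ring

/-- The weak solutions of `u' = c u` are the multiples of `e^{cx}`. -/
theorem IsWeakDeriv.exists_ae_eq_exp {u : HalfLineL2} {c : ℂ} (h : IsWeakDeriv u (c • u)) :
    ∃ a : ℂ, u =ᵐ[volume.restrict (Ioi (0 : ℝ))] fun x => a * Complex.exp (c * x) := by
  have hexp : ContDiff ℝ ∞ fun x : ℝ => Complex.exp (-(c * x)) := by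
    have : ContDiff ℝ ∞ fun x : ℝ => (x : ℂ) := Complex.ofRealCLM.contDiff
    exact (contDiff_const.mul this).neg.cexp
  have hexpd : ∀ x : ℝ, HasDerivAt (fun x : ℝ => Complex.exp (-(c * x)))
      (Complex.exp (-(c * x)) * -c) x := by
    intro x
    have := ((hasDerivAt_id x).ofReal_comp.const_mul c).neg.cexp
    simpa using this
  have key := exists_ae_eq_const_of_integral_deriv_smul_eq_zero
    (v := fun x => Complex.exp (-(c * x)) * u x) ?_ ?_
  · obtain ⟨a, ha⟩ := key
    refine ⟨a, ?_⟩
    filter_upwards [ha] with x hx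
    rw [← hx, mul_right_comm, ← Complex.exp_add, neg_add_cancel, Complex.exp_zero, one_mul]
  · have h1 : LocallyIntegrable (fun x => u x) (volume.restrict (Ioi (0 : ℝ))) :=
      (Lp.memLp u).locallyIntegrable (by norm_num)
    rw [← locallyIntegrableOn_univ] at h1 ⊢
    exact h1.continuousOn_mul hexp.continuous.continuousOn isOpen_univ.isLocallyClosed
  · intro η hη hc hs
    have hη' : ContDiff ℝ ∞ fun x => (η x : ℂ) := Complex.ofRealCLM.contDiff.comp hη
    have hηd : ∀ x, HasDerivAt (fun x => (η x : ℂ)) (deriv η x : ℝ) x := fun x =>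
      (hη.differentiable (by simp) x).hasDerivAt.ofReal_comp
    have hcc : HasCompactSupport fun x => (η x : ℂ) := hc.comp_left (g := Complex.ofReal) rfl
    have hss : tsupport (fun x => (η x : ℂ)) ⊆ Ioi 0 :=
      (tsupport_comp_subset (g := Complex.ofReal) rfl η).trans hs
    have hθ := h.integral_complex_test (hη'.mul hexp) hcc.mul_right
      ((tsupport_mul_subset_left).trans hss)
    have hθd : deriv (fun x => (η x : ℂ) * Complex.exp (-(c * x))) = fun x : ℝ =>
        (deriv η x : ℝ) * Complex.exp (-(c * x)) + η x * (Complex.exp (-(c * x)) * -c) :=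
      funext fun x => ((hηd x).mul (hexpd x)).deriv
    rw [hθd] at hθ
    have hcoe : ∀ {ψ : ℝ → ℝ}, Continuous ψ → HasCompactSupport ψ → Integrable
        (fun x : ℝ => ((ψ x : ℂ) * Complex.exp (-(c * x))) * u x)
          (volume.restrict (Ioi (0 : ℝ))) := by
      intro ψ hψ hψc
      have hl : LocallyIntegrable (fun x => u x) (volume.restrict (Ioi (0 : ℝ))) :=
        (Lp.memLp u).locallyIntegrable (by norm_num)
      refine hl.integrable_smul_left_of_hasCompactSupport
        ((Complex.continuous_ofReal.comp hψ).mul hexp.continuous) ?_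
      exact HasCompactSupport.mul_right (hψc.comp_left (g := Complex.ofReal) rfl)
    have i1 := hcoe (hη.continuous_deriv (by simp)) hc.deriv
    have i2 := hcoe hη.continuous hc
    have e1 : ∫ x in Ioi (0 : ℝ), (η x : ℂ) * Complex.exp (-(c * x)) * (c • u : HalfLineL2) x =
        c * ∫ x in Ioi (0 : ℝ), (η x : ℂ) * Complex.exp (-(c * x)) * u x := by
      rw [← integral_const_mul]
      refine integral_congr_ae ?_
      filter_upwards [Lp.coeFn_smul c u] with x hx
      rw [hx, Pi.smul_apply, smul_eq_mul]
      ring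
    have e2 : ∫ x in Ioi (0 : ℝ), ((deriv η x : ℝ) * Complex.exp (-(c * x)) +
        η x * (Complex.exp (-(c * x)) * -c)) * u x =
        (∫ x in Ioi (0 : ℝ), ((deriv η x : ℝ) : ℂ) * Complex.exp (-(c * x)) * u x) -
          c * ∫ x in Ioi (0 : ℝ), (η x : ℂ) * Complex.exp (-(c * x)) * u x := by
      rw [← integral_const_mul, ← integral_sub i1 (i2.const_mul c)]
      refine integral_congr_ae (Filter.Eventually.of_forall fun x => ?_)
      dsimp only
      ring
    have e3 : ∫ x in Ioi (0 : ℝ), deriv η x • (Complex.exp (-(c * x)) * u x) =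
        ∫ x in Ioi (0 : ℝ), ((deriv η x : ℝ) : ℂ) * Complex.exp (-(c * x)) * u x := by
      refine integral_congr_ae (Filter.Eventually.of_forall fun x => ?_)
      dsimp only
      rw [Complex.real_smul, mul_assoc]
    rw [e3]
    rw [e2, e1] at hθ
    linear_combination hθ

/-! ### Bounded solution operators of the scalar equations -/

lemma memLp_exp {c : ℂ} (hc : c.re < 0) :
    MemLp (fun x : ℝ => Complex.exp (c * x)) 2 (volume.restrict (Ioi (0 : ℝ))) := by
  have hm : AEStronglyMeasurable (fun x : ℝ => Complex.exp (c * x))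
      (volume.restrict (Ioi (0 : ℝ))) :=
    Continuous.aestronglyMeasurable (by fun_prop)
  rw [memLp_two_iff_integrable_sq_norm hm]
  have h := integrableOn_exp_mul_Ioi (a := 2 * c.re) (by linarith) 0
  refine h.congr (Filter.Eventually.of_forall fun x => ?_)
  dsimp only
  rw [Complex.norm_exp, ← Real.exp_nat_mul]
  congr 1
  simp
  ring

/-- The decaying exponential `e^{cx}`, `Re c < 0`, as an element of `L²((0, ∞); ℂ)`. -/
def expL2 (c : ℂ) (hc : c.re < 0) : HalfLineL2 := (memLp_exp hc).toLp _

variable {c : ℂ}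

lemma coeFn_expL2 (hc : c.re < 0) :
    expL2 c hc =ᵐ[volume.restrict (Ioi (0 : ℝ))] fun x => Complex.exp (c * x) :=
  (memLp_exp hc).coeFn_toLp

lemma intervalIntegral_zero_halfLineL2 (f : ℝ → ℂ) {x : ℝ} (hx : 0 ≤ x) :
    ∫ t in 0..x, f t * (0 : HalfLineL2) t = 0 := by
  rw [intervalIntegral.integral_of_le hx]
  refine integral_eq_zero_of_ae ?_
  filter_upwards [ae_restrict_of_ae_restrict_of_subset Ioc_subset_Ioi_self
    (Lp.coeFn_zero ℂ 2 (volume.restrict (Ioi (0 : ℝ))))] with t ht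
  rw [ht]
  simp

lemma expL2_spec (hc : c.re < 0) :
    IsWeakDeriv (expL2 c hc) (c • expL2 c hc) ∧ HasTrace (expL2 c hc) 1 := by
  have h := isWeakDeriv_variation_of_constants (u := expL2 c hc) (g := 0) (c := c) (C := 1) ?_
  · rwa [add_zero] at h
  · filter_upwards [coeFn_expL2 hc, ae_restrict_mem measurableSet_Ioi] with x hx hx0
    rw [hx, intervalIntegral_zero_halfLineL2 _ (le_of_lt hx0), add_zero, mul_one]

lemma isWeakDeriv_expL2 (hc : c.re < 0) : IsWeakDeriv (expL2 c hc) (c • expL2 c hc) :=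
  (expL2_spec hc).1

lemma hasTrace_expL2 (hc : c.re < 0) : HasTrace (expL2 c hc) 1 := (expL2_spec hc).2

lemma hasTrace_smul_expL2 (hc : c.re < 0) (a : ℂ) : HasTrace (a • expL2 c hc) a := by
  simpa using (hasTrace_expL2 hc).smul a

lemma IsWeakDeriv.eq_smul_expL2 (hc : c.re < 0) {u : HalfLineL2} (h : IsWeakDeriv u (c • u)) :
    ∃ a : ℂ, u = a • expL2 c hc := by
  obtain ⟨a, ha⟩ := h.exists_ae_eq_exp
  refine ⟨a, Lp.ext ?_⟩
  filter_upwards [ha, coeFn_expL2 hc, Lp.coeFn_smul a (expL2 c hc)] with x h1 h2 h3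
  rw [h1, h3, Pi.smul_apply, h2, smul_eq_mul]

/-- No nonzero multiple of a growing exponential is square-integrable. -/
lemma IsWeakDeriv.eq_zero_of_re_neg (hc : c.re < 0) {u : HalfLineL2}
    (h : IsWeakDeriv u (-c • u)) : u = 0 := by
  obtain ⟨a, ha⟩ := h.exists_ae_eq_exp
  have hmem : MemLp (fun _ : ℝ => a) 2 (volume.restrict (Ioi (0 : ℝ))) := by
    refine (Lp.memLp u).mono aestronglyMeasurable_const ?_
    filter_upwards [ha, ae_restrict_mem measurableSet_Ioi] with x hx hx0
    rw [hx, norm_mul, Complex.norm_exp]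
    refine le_mul_of_one_le_right (norm_nonneg _) (Real.one_le_exp ?_)
    have : 0 ≤ -c.re * x := mul_nonneg (by linarith) (le_of_lt hx0)
    simpa using this
  have ha0 : a = 0 := by
    rw [memLp_const_iff (by norm_num) (by norm_num)] at hmem
    simpa using hmem
  refine Lp.ext ?_
  filter_upwards [ha, Lp.coeFn_zero ℂ 2 (volume.restrict (Ioi (0 : ℝ)))] with x h1 h2
  rw [h1, h2, ha0, zero_mul, Pi.zero_apply]

/-- The bounded solution operator of `u' = c u + g`, `u(0) = 0`, for `Re c < 0`. -/
theorem exists_forward_solution (hc : c.re < 0) :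
    ∃ P : HalfLineL2 →L[ℂ] HalfLineL2, ∀ g,
      IsWeakDeriv (P g) (c • P g + g) ∧ HasTrace (P g) 0 := by
  obtain ⟨P, hP⟩ := exists_convolution_operator
    (κ := (Ioi (0 : ℝ)).indicator fun s : ℝ => Complex.exp (c * s))
    ((Continuous.measurable (by fun_prop)).indicator measurableSet_Ioi)
    ((integrable_indicator_iff measurableSet_Ioi).mpr (integrableOn_exp_mul_complex_Ioi hc 0))
  refine ⟨P, fun g => isWeakDeriv_variation_of_constants ?_⟩
  filter_upwards [hP g, ae_restrict_mem measurableSet_Ioi] with x hx hx0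
  have e : (fun y => (Ioi (0 : ℝ)).indicator (fun s : ℝ => Complex.exp (c * s)) (x - y) * g y) =
      (Iio x).indicator fun y : ℝ => Complex.exp (c * x) * (Complex.exp (-(c * y)) * g y) := by
    ext y
    simp only [indicator, mem_Ioi, mem_Iio, sub_pos]
    split_ifs
    · rw [← mul_assoc, ← Complex.exp_add]
      congr 2
      push_cast
      ring
    · rw [zero_mul]
  rw [hx, e, setIntegral_indicator measurableSet_Iio, Ioi_inter_Iio, integral_const_mul,
    zero_add, intervalIntegral.integral_of_le (le_of_lt hx0), integral_Ioc_eq_integral_Ioo]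

/-- The bounded solution operator of `u' = -c u + g` for `Re c < 0`: square-integrability selects
one solution, whose boundary value is a bounded functional of `g`. -/
theorem exists_backward_solution (hc : c.re < 0) :
    ∃ (Q : HalfLineL2 →L[ℂ] HalfLineL2) (l : HalfLineL2 →L[ℂ] ℂ), ∀ g,
      IsWeakDeriv (Q g) (-c • Q g + g) ∧ HasTrace (Q g) (l g) := by
  obtain ⟨Q, hQ⟩ := exists_convolution_operator
    (κ := (Iio (0 : ℝ)).indicator fun s : ℝ => -Complex.exp (-c * s))
    ((Continuous.measurable (by fun_prop)).indicator measurableSet_Iio)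
    ((integrable_indicator_iff measurableSet_Iio).mpr
      (((integrableOn_exp_mul_complex_Iic (a := -c) (by simpa using hc) 0).mono_set
        Iio_subset_Iic_self).neg))
  have hc' : ((starRingEnd ℂ) c).re < 0 := by simpa using hc
  -- the boundary value is `-∫ e^{ct} g(t) dt`
  refine ⟨Q, -innerSL ℂ (expL2 _ hc'), fun g => isWeakDeriv_variation_of_constants ?_⟩
  have hprod : ∀ᵐ y ∂(volume.restrict (Ioi (0 : ℝ))),
      inner ℂ (expL2 _ hc' y) (g y) = Complex.exp (-(-c * y)) * g y := by
    filter_upwards [coeFn_expL2 hc'] with y hy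
    rw [hy, RCLike.inner_apply', ← Complex.exp_conj]
    simp
  have hl : (-innerSL ℂ (expL2 _ hc')) g =
      -∫ y in Ioi (0 : ℝ), Complex.exp (-(-c * y)) * g y := by
    rw [neg_apply, innerSL_apply_apply, L2.inner_def, integral_congr_ae hprod]
  have hint : IntegrableOn (fun y : ℝ => Complex.exp (-(-c * y)) * g y) (Ioi 0) :=
    (L2.integrable_inner (expL2 _ hc') g).congr hprod
  filter_upwards [hQ g, ae_restrict_mem measurableSet_Ioi] with x hx hx0
  have e : (fun y => (Iio (0 : ℝ)).indicator (fun s : ℝ => -Complex.exp (-c * s)) (x - y) * g y) =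
      (Ioi x).indicator fun y : ℝ =>
        -Complex.exp (-c * x) * (Complex.exp (-(-c * y)) * g y) := by
    ext y
    simp only [indicator, mem_Ioi, mem_Iio, sub_neg]
    split_ifs
    · rw [← mul_assoc, neg_mul _ (Complex.exp _), ← Complex.exp_add]
      congr 3
      push_cast
      ring
    · rw [zero_mul]
  have hsplit : ∫ y in Ioi (0 : ℝ), Complex.exp (-(-c * y)) * g y =
      (∫ y in Ioc 0 x, Complex.exp (-(-c * y)) * g y) +
        ∫ y in Ioi x, Complex.exp (-(-c * y)) * g y := by
    rw [← setIntegral_union (Ioc_disjoint_Ioi le_rfl) measurableSet_Ioi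
      (hint.mono_set Ioc_subset_Ioi_self) (hint.mono_set (Ioi_subset_Ioi (le_of_lt hx0))),
      Ioc_union_Ioi_eq_Ioi (le_of_lt hx0)]
  rw [hx, e, setIntegral_indicator measurableSet_Ioi, Ioi_inter_Ioi,
    sup_eq_right.mpr (le_of_lt hx0), integral_const_mul, hl, hsplit,
    intervalIntegral.integral_of_le (le_of_lt hx0)]
  ring

/-! ### Eigenvalues and resolvent of the Dirac operator with a vertex condition -/

variable {N : ℕ}

lemma weakDeriv_eq_iff (u : H1) (g : HalfLineL2) : weakDeriv u = g ↔ IsWeakDeriv u g :=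
  ⟨fun h => h ▸ isWeakDeriv_weakDeriv u, fun h => (isWeakDeriv_weakDeriv u).unique h⟩

lemma neg_I_smul_add_sub_eq_iff {V : Type*} [AddCommGroup V] [Module ℂ V] (d w f : V) (a z : ℂ) :
    -Complex.I • d + a • w - z • w = f ↔ d = Complex.I • ((z - a) • w + f) := by
  have hI := Complex.I_mul_I
  constructor
  · rintro rfl
    match_scalars
    · linear_combination hI
    · ring
  · rintro rfl
    match_scalars
    · linear_combination (a - z) * hI
    · linear_combination -hI

/-- The equation `(D - z) Φ = F` for the maximal operator, as a first-order system. -/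
lemma diracMax_sub_eq_iff (m : ℝ) (z : ℂ) (Φ : starH1 N) (F : StarL2 N) :
    diracMax N m Φ - z • (Φ : StarL2 N) = F ↔ ∀ e,
      IsWeakDeriv ((Φ : StarL2 N) e 0)
        (Complex.I • ((z + m) • (Φ : StarL2 N) e 1 + F e 1)) ∧
      IsWeakDeriv ((Φ : StarL2 N) e 1)
        (Complex.I • ((z - m) • (Φ : StarL2 N) e 0 + F e 0)) := by
  have h0 : ∀ e, (diracMax N m Φ - z • (Φ : StarL2 N)) e 0 =
      -Complex.I • compDeriv e 1 Φ + (m : ℂ) • (Φ : StarL2 N) e 0 - z • (Φ : StarL2 N) e 0 :=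
    fun e => rfl
  have h1 : ∀ e, (diracMax N m Φ - z • (Φ : StarL2 N)) e 1 =
      -Complex.I • compDeriv e 0 Φ - (m : ℂ) • (Φ : StarL2 N) e 1 - z • (Φ : StarL2 N) e 1 :=
    fun e => rfl
  have hc : ∀ e j g, IsWeakDeriv ((Φ : StarL2 N) e j) g ↔ compDeriv e j Φ = g :=
    fun e j g => (weakDeriv_eq_iff ⟨(Φ : StarL2 N) e j, Φ.2 e j⟩ g).symm
  have hext : diracMax N m Φ - z • (Φ : StarL2 N) = F ↔ ∀ e,
      (diracMax N m Φ - z • (Φ : StarL2 N)) e 1 = F e 1 ∧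
      (diracMax N m Φ - z • (Φ : StarL2 N)) e 0 = F e 0 := by
    constructor
    · rintro rfl e
      exact ⟨rfl, rfl⟩
    · intro h
      refine PiLp.ext fun e => PiLp.ext fun j => ?_
      revert j
      exact Fin.forall_fin_two.mpr ⟨(h e).2, (h e).1⟩
  rw [hext]
  refine forall_congr' fun e => and_congr ?_ ?_
  · rw [hc, h1, sub_eq_add_neg _ ((m : ℂ) • _), ← neg_smul, neg_I_smul_add_sub_eq_iff,
      sub_neg_eq_add]
  · rw [hc, h0, neg_I_smul_add_sub_eq_iff]

/-- The equation `(D^{Λ_{A,B}} - z) Φ = F`, as a first-order system with a vertex condition. -/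
lemma diracAB_sub_eq_iff (m : ℝ) (A B : Matrix (Fin N) (Fin N) ℂ) (z : ℂ) (Φ F : StarL2 N) :
    (∃ x : (diracAB m A B).domain, (x : StarL2 N) = Φ ∧
      diracAB m A B x - z • (x : StarL2 N) = F) ↔
    Φ ∈ boundaryCondition (relation A B) ∧ ∀ e,
      IsWeakDeriv (Φ e 0) (Complex.I • ((z + m) • Φ e 1 + F e 1)) ∧
      IsWeakDeriv (Φ e 1) (Complex.I • ((z - m) • Φ e 0 + F e 0)) := by
  have happly : ∀ x : (diracAB m A B).domain, diracAB m A B x = diracMax N m ⟨x, x.2.2⟩ :=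
    fun x => LinearPMap.domRestrict_apply rfl
  constructor
  · rintro ⟨⟨Ψ, hΨ⟩, rfl, hx⟩
    rw [happly] at hx
    exact ⟨hΨ.1, (diracMax_sub_eq_iff m z ⟨Ψ, hΨ.2⟩ F).mp hx⟩
  · rintro ⟨hb, h⟩
    have hH : Φ ∈ starH1 N := by
      intro e j
      fin_cases j
      exacts [⟨_, (h e).1⟩, ⟨_, (h e).2⟩]
    refine ⟨⟨Φ, hb, hH⟩, rfl, ?_⟩
    rw [happly]
    exact (diracMax_sub_eq_iff m z ⟨Φ, hH⟩ F).mpr h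

/-- The combinations `φ¹ ± α φ²` decouple the system. -/
lemma isWeakDeriv_decouple {z k α : ℂ} {m : ℝ} (h1 : z + m = k * α) (h2 : α * (z - m) = k)
    {p q f g : HalfLineL2}
    (hp : IsWeakDeriv p (Complex.I • ((z + m) • q + g)))
    (hq : IsWeakDeriv q (Complex.I • ((z - m) • p + f))) :
    IsWeakDeriv (p + α • q)
      ((Complex.I * k) • (p + α • q) + Complex.I • (g + α • f)) ∧
    IsWeakDeriv (p - α • q)
      (-(Complex.I * k) • (p - α • q) + Complex.I • (g - α • f)) := by
  constructor
  · convert hp.add (hq.smul α) using 1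
    match_scalars
    · linear_combination -Complex.I * h2
    · linear_combination -Complex.I * h1
    · ring
    · ring
  · convert hp.add (hq.smul (-α)) using 1
    · module
    · match_scalars
      · linear_combination Complex.I * h2
      · linear_combination -Complex.I * h1
      · ring
      · ring

/-- The converse of `isWeakDeriv_decouple`. -/
lemma isWeakDeriv_recouple {z k α : ℂ} {m : ℝ} (hα : α ≠ 0) (h1 : z + m = k * α)
    (h2 : α * (z - m) = k) {u v f g : HalfLineL2}
    (hu : IsWeakDeriv u ((Complex.I * k) • u + Complex.I • (g + α • f)))
    (hv : IsWeakDeriv v (-(Complex.I * k) • v + Complex.I • (g - α • f))) :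
    IsWeakDeriv ((1 / 2 : ℂ) • (u + v))
      (Complex.I • ((z + m) • (1 / (2 * α)) • (u - v) + g)) ∧
    IsWeakDeriv ((1 / (2 * α)) • (u - v))
      (Complex.I • ((z - m) • (1 / 2 : ℂ) • (u + v) + f)) := by
  have hz : z - m = k / α := by rw [← h2]; field_simp
  constructor
  · convert (hu.add hv).smul (1 / 2 : ℂ) using 1
    rw [h1]
    match_scalars <;> field_simp <;> ring
  · convert (hu.add (hv.smul (-1))).smul (1 / (2 * α)) using 1
    · module
    · rw [hz]
      match_scalars <;> field_simp <;> ring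

lemma I_mul_re_neg {k : ℂ} (hk : 0 < k.im) : (Complex.I * k).re < 0 := by simpa using hk

lemma pencil_mulVec (A B : Matrix (Fin N) (Fin N) ℂ) (μ : ℂ) (v : Fin N → ℂ) :
    (pencil A B μ).mulVec v = A.mulVec v - μ • B.mulVec v := by
  rw [pencil, Matrix.sub_mulVec, Matrix.smul_mulVec]

lemma mem_relation {A B : Matrix (Fin N) (Fin N) ℂ} {f f' : Fin N → ℂ} :
    (f, f') ∈ relation A B ↔ A.mulVec f = B.mulVec f' := Iff.rfl

/-- Off the spectrum of the reference operator, `z` is an eigenvalue exactly when the pencil is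
singular at `i / α`: the square-integrable solutions of `D Φ = z Φ` are `(α a, a) e^{ikx}` with
`a ∈ ℂ^N`, and the vertex condition for them reads `L(i / α) a = 0`. -/
theorem mem_pointSpec_iff {m : ℝ} (A B : Matrix (Fin N) (Fin N) ℂ) {z k α : ℂ} (hk : 0 < k.im)
    (hα : α ≠ 0) (h1 : z + m = k * α) (h2 : α * (z - m) = k) :
    z ∈ pointSpec (diracAB m A B) ↔ (pencil A B (Complex.I / α)).det = 0 := by
  have hc := I_mul_re_neg hk
  constructor
  · rintro ⟨x, hx0, hx⟩
    obtain ⟨hb, hd⟩ := (diracAB_sub_eq_iff m A B z x 0).mp ⟨x, rfl, by rw [hx, sub_self]⟩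
    have hdec := fun e => isWeakDeriv_decouple h1 h2 (hd e).1 (hd e).2
    have hz : ∀ e j, (0 : StarL2 N) e j = 0 := fun e j => rfl
    simp only [hz, smul_zero, add_zero, sub_zero] at hdec
    have hm : ∀ e, (x : StarL2 N) e 0 - α • (x : StarL2 N) e 1 = 0 := fun e =>
      (hdec e).2.eq_zero_of_re_neg hc
    choose a ha using fun e => (hdec e).1.eq_smul_expL2 hc
    have hx1 : ∀ e, (x : StarL2 N) e 0 = (a e / 2) • expL2 _ hc := by
      intro e
      rw [div_eq_inv_mul, mul_smul, ← ha e, ← sub_eq_zero.mp (hm e)]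
      module
    have hx2 : ∀ e, (x : StarL2 N) e 1 = (a e / (2 * α)) • expL2 _ hc := by
      intro e
      have : α • (x : StarL2 N) e 1 = α • (a e / (2 * α)) • expL2 _ hc := by
        rw [← sub_eq_zero.mp (hm e), hx1 e, smul_smul]
        congr 1
        field_simp
      exact smul_right_injective _ hα this
    have ha0 : a ≠ 0 := by
      rintro rfl
      refine hx0 ?_
      ext e j : 2
      fin_cases j
      · exact (hx1 e).trans (by simp)
      · exact (hx2 e).trans (by simp)
    obtain ⟨f, f', hff, hL⟩ := hb
    have hf : f = (1 / 2 : ℂ) • a := by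
      ext e
      refine (hff e).1.unique ?_
      rw [hx1 e]
      convert hasTrace_smul_expL2 hc (a e / 2) using 1
      simp [div_eq_inv_mul]
    have hf' : f' = (1 / 2 * (Complex.I / α)) • a := by
      ext e
      refine (hff e).2.unique ?_
      rw [hx2 e, smul_smul]
      convert hasTrace_smul_expL2 hc (Complex.I * (a e / (2 * α))) using 1
      simp only [Pi.smul_apply, smul_eq_mul]
      field_simp
    rw [mem_relation, hf, hf', Matrix.mulVec_smul, Matrix.mulVec_smul, mul_smul] at hL
    have hL' := smul_right_injective _ (by norm_num : (1 / 2 : ℂ) ≠ 0) hL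
    refine Matrix.exists_mulVec_eq_zero_iff.mp ⟨a, ha0, ?_⟩
    rw [pencil_mulVec, hL', sub_self]
  · intro hdet
    obtain ⟨a, ha0, ha⟩ := Matrix.exists_mulVec_eq_zero_iff.mpr hdet
    rw [pencil_mulVec, sub_eq_zero] at ha
    set Φ : StarL2 N := WithLp.toLp 2 fun e => WithLp.toLp 2
      ![(α * a e) • expL2 _ hc, a e • expL2 _ hc] with hΦ
    have p0 : ∀ e, Φ e 0 = (α * a e) • expL2 _ hc := fun e => rfl
    have p1 : ∀ e, Φ e 1 = a e • expL2 _ hc := fun e => rfl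
    obtain ⟨x, hx, hxz⟩ := (diracAB_sub_eq_iff m A B z Φ 0).mpr (by
      refine ⟨⟨α • a, Complex.I • a, fun e => ⟨?_, ?_⟩, ?_⟩, fun e => ⟨?_, ?_⟩⟩
      · exact hasTrace_smul_expL2 hc _
      · rw [p1, smul_smul]
        exact hasTrace_smul_expL2 hc _
      · rw [mem_relation, Matrix.mulVec_smul, Matrix.mulVec_smul, ha, smul_smul]
        congr 1
        field_simp
      · rw [p0, p1]
        convert (isWeakDeriv_expL2 hc).smul (α * a e) using 1
        change Complex.I • ((z + m) • a e • expL2 _ hc + (0 : HalfLineL2)) = _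
        rw [h1]
        module
      · rw [p0, p1]
        convert (isWeakDeriv_expL2 hc).smul (a e) using 1
        change Complex.I • ((z - m) • (α * a e) • expL2 _ hc + (0 : HalfLineL2)) = _
        match_scalars
        linear_combination Complex.I * a e * h2)
    refine ⟨x, ?_, sub_eq_zero.mp hxz⟩
    rw [hx]
    intro h0
    refine ha0 (funext fun e => ?_)
    have h3 := hasTrace_smul_expL2 hc (a e)
    rw [← p1 e, h0] at h3
    exact h3.unique hasTrace_zero

/-- Off the spectrum of the reference operator, `z` belongs to the resolvent set when the pencil
is regular at `i / α`. -/
theorem mem_resolventSet_of_det_ne_zero {m : ℝ} (A B : Matrix (Fin N) (Fin N) ℂ) {z k α : ℂ}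
    (hk : 0 < k.im) (hα : α ≠ 0) (h1 : z + m = k * α) (h2 : α * (z - m) = k)
    (hdet : (pencil A B (Complex.I / α)).det ≠ 0) : z ∈ resolventSet (diracAB m A B) := by
  have hc := I_mul_re_neg hk
  obtain ⟨P, hP⟩ := exists_forward_solution hc
  obtain ⟨Q, l, hQ⟩ := exists_backward_solution hc
  set L := pencil A B (Complex.I / α) with hL
  set M : Matrix (Fin N) (Fin N) ℂ := -(L⁻¹ * (A + (Complex.I / α) • B)) with hM
  let pr : Fin N → Fin 2 → StarL2 N →L[ℂ] HalfLineL2 := fun e j =>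
    (PiLp.proj 2 (fun _ : Fin 2 => HalfLineL2) j : EdgeL2 →L[ℂ] HalfLineL2).comp
      (PiLp.proj 2 (fun _ : Fin N => EdgeL2) e)
  let gp : Fin N → StarL2 N →L[ℂ] HalfLineL2 := fun e => Complex.I • (pr e 1 + α • pr e 0)
  let gm : Fin N → StarL2 N →L[ℂ] HalfLineL2 := fun e => Complex.I • (pr e 1 - α • pr e 0)
  -- the coefficients of the decaying exponential, chosen so that the vertex condition holds
  let a : Fin N → StarL2 N →L[ℂ] ℂ := fun e => ∑ e', M e e' • l.comp (gm e')
  let u : Fin N → StarL2 N →L[ℂ] HalfLineL2 := fun e =>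
    P.comp (gp e) + (a e).smulRight (expL2 _ hc)
  let v : Fin N → StarL2 N →L[ℂ] HalfLineL2 := fun e => Q.comp (gm e)
  let R : StarL2 N →L[ℂ] StarL2 N :=
    (PiLp.continuousLinearEquiv 2 ℂ (fun _ : Fin N => EdgeL2)).symm.toContinuousLinearMap.comp
      (ContinuousLinearMap.pi fun e =>
        (PiLp.continuousLinearEquiv 2 ℂ
          (fun _ : Fin 2 => HalfLineL2)).symm.toContinuousLinearMap.comp
          (ContinuousLinearMap.pi
            ![(1 / 2 : ℂ) • (u e + v e), (1 / (2 * α)) • (u e - v e)]))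
  have hR0 : ∀ F e, R F e 0 = (1 / 2 : ℂ) • (u e F + v e F) := fun F e => rfl
  have hR1 : ∀ F e, R F e 1 = (1 / (2 * α)) • (u e F - v e F) := fun F e => rfl
  have hgp : ∀ F e, gp e F = Complex.I • (F e 1 + α • F e 0) := fun F e => rfl
  have hgm : ∀ F e, gm e F = Complex.I • (F e 1 - α • F e 0) := fun F e => rfl
  have hu : ∀ F e, u e F = P (gp e F) + a e F • expL2 _ hc := fun F e => rfl
  have hv : ∀ F e, v e F = Q (gm e F) := fun F e => rfl
  have hsol : ∀ F : StarL2 N, ∃ x : (diracAB m A B).domain, (x : StarL2 N) = R F ∧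
      diracAB m A B x - z • (x : StarL2 N) = F := by
    intro F
    set b : Fin N → ℂ := fun e => l (gm e F) with hb
    have ha : (fun e => a e F) = M.mulVec b := by
      ext e
      simp only [a, Matrix.mulVec, dotProduct, hb]
      rw [sum_apply]
      rfl
    have htu : ∀ e, HasTrace (u e F) (a e F) := by
      intro e
      rw [hu]
      simpa using (hP (gp e F)).2.add (hasTrace_smul_expL2 hc (a e F))
    have htv : ∀ e, HasTrace (v e F) (b e) := fun e => (hQ (gm e F)).2
    have hdu : ∀ e, IsWeakDeriv (u e F)
        ((Complex.I * k) • u e F + Complex.I • (F e 1 + α • F e 0)) := by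
      intro e
      rw [← hgp, hu]
      convert (hP (gp e F)).1.add ((isWeakDeriv_expL2 hc).smul (a e F)) using 1
      module
    have hdv : ∀ e, IsWeakDeriv (v e F)
        (-(Complex.I * k) • v e F + Complex.I • (F e 1 - α • F e 0)) := by
      intro e
      rw [← hgm, hv]
      exact (hQ (gm e F)).1
    refine (diracAB_sub_eq_iff m A B z (R F) F).mpr ⟨⟨(1 / 2 : ℂ) • ((fun e => a e F) + b),
      (Complex.I * (1 / (2 * α))) • ((fun e => a e F) - b), fun e => ⟨?_, ?_⟩, ?_⟩, fun e => ?_⟩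
    · rw [hR0]
      exact ((htu e).add (htv e)).smul _
    · rw [hR1, smul_smul]
      convert ((htu e).add ((htv e).smul (-1))).smul (Complex.I * (1 / (2 * α))) using 1
      · module
      · simp [sub_eq_add_neg]
    · rw [mem_relation, Matrix.mulVec_smul, Matrix.mulVec_smul, Matrix.mulVec_add,
        Matrix.mulVec_sub]
      have hLa : L.mulVec (M.mulVec b) = -(A.mulVec b + (Complex.I / α) • B.mulVec b) := by
        rw [hM, Matrix.neg_mulVec, Matrix.mulVec_neg, Matrix.mulVec_mulVec, ← Matrix.mul_assoc,
          Matrix.mul_nonsing_inv _ (isUnit_iff_ne_zero.mpr hdet), Matrix.one_mul,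
          Matrix.add_mulVec, Matrix.smul_mulVec]
      rw [hL, pencil_mulVec, ← ha] at hLa
      have hLa' := sub_eq_iff_eq_add.mp hLa
      rw [hLa']
      match_scalars <;> field_simp
      ring
    · rw [hR0, hR1]
      exact isWeakDeriv_recouple hα h1 h2 (hdu e) (hdv e)
  refine ⟨R, hsol, fun x => ?_⟩
  obtain ⟨y, hy, hyx⟩ := hsol (diracAB m A B x - z • (x : StarL2 N))
  rw [← hy]
  -- a second preimage would differ from the first one by an eigenfunction
  by_contra hne
  refine hdet ((mem_pointSpec_iff A B hk hα h1 h2).mp ⟨y - x, ?_, ?_⟩)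
  · rw [Submodule.coe_sub]
    exact sub_ne_zero.mpr hne
  · rw [LinearPMap.map_sub, Submodule.coe_sub, smul_sub]
    exact sub_eq_sub_iff_sub_eq_sub.mp hyx

/-! ### The spectrum of an unbounded operator -/

section Spectrum

variable {H : Type*} [NormedAddCommGroup H] [NormedSpace ℂ H]

lemma pointSpec_subset_spec (T : H →ₗ.[ℂ] H) : pointSpec T ⊆ spec T := by
  rintro z ⟨x, hx0, hx⟩ ⟨R, -, hR⟩
  refine hx0 ?_
  rw [← hR x, hx, sub_self, map_zero]

/-- The resolvent set is open, by the Neumann series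
`(T - w)⁻¹ = (T - z)⁻¹ (1 - (w - z) (T - z)⁻¹)⁻¹`. -/
theorem isClosed_spec [CompleteSpace H] (T : H →ₗ.[ℂ] H) : IsClosed (spec T) := by
  rw [spec, isClosed_compl_iff, Metric.isOpen_iff]
  rintro z ⟨R, hR1, hR2⟩
  refine ⟨1 / (‖R‖ + 1), by positivity, fun w hw => ?_⟩
  rw [mem_ball_iff_norm] at hw
  have hlt : ‖(w - z) • R‖ < 1 := by
    rw [norm_smul]
    calc ‖w - z‖ * ‖R‖ ≤ ‖w - z‖ * (‖R‖ + 1) := by gcongr; linarith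
      _ < 1 / (‖R‖ + 1) * (‖R‖ + 1) := by gcongr
      _ = 1 := by field_simp
  obtain ⟨U, hU⟩ := isUnit_one_sub_of_norm_lt_one hlt
  have hinv1 : ∀ y, (U : H →L[ℂ] H) ((↑U⁻¹ : H →L[ℂ] H) y) = y := fun y => by
    rw [← mul_apply_eq_comp, Units.mul_inv, one_apply_eq_self]
  have hinv2 : ∀ y, (↑U⁻¹ : H →L[ℂ] H) ((U : H →L[ℂ] H) y) = y := fun y => by
    rw [← mul_apply_eq_comp, Units.inv_mul, one_apply_eq_self]
  have hUa : ∀ y, (U : H →L[ℂ] H) y = y - (w - z) • R y := fun y => by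
    rw [hU]
    rfl
  refine ⟨R * ↑U⁻¹, fun y => ?_, fun x => ?_⟩
  · obtain ⟨x, hx, hxy⟩ := hR1 ((↑U⁻¹ : H →L[ℂ] H) y)
    refine ⟨x, hx, ?_⟩
    have h1 := hinv1 y
    rw [hUa, ← hx, ← hxy] at h1
    rw [← h1]
    module
  · rw [mul_apply_eq_comp]
    have h1 : T x - w • (x : H) = (U : H →L[ℂ] H) (T x - z • (x : H)) := by
      rw [hUa, hR2]
      module
    rw [h1, hinv2, hR2]

end Spectrum

variable {N : ℕ}

/-! ### The reference operator at real points outside the gap -/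

lemma diracZero_eq_diracAB (N : ℕ) (m : ℝ) : diracZero N m = diracAB m 1 0 := by
  rw [diracZero, diracAB]
  congr 1
  ext ⟨f, f'⟩
  rw [mem_relation]
  simp

/-- At real `z` with `|z| > m`, the reference operator has approximate eigenfunctions: damping the
standing wave `(i α sin kx, cos kx)` by `e^{-εx}` yields `Φ` with `(D⁰ - z) Φ = i ε σ₁ Φ`. -/
theorem mem_spec_diracZero (hN : 1 ≤ N) {m k : ℝ} {z α : ℂ} (hα : α ≠ 0)
    (h1 : z + m = k * α) (h2 : α * (z - m) = k) : z ∈ spec (diracZero N m) := by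
  rw [diracZero_eq_diracAB]
  rintro ⟨R, -, hR⟩
  set ε : ℝ := 1 / (‖R‖ + 1) with hε
  have hε0 : 0 < ε := by positivity
  have hc1 : (Complex.I * k - ε : ℂ).re < 0 := by simpa using hε0
  have hc2 : (-(Complex.I * k) - ε : ℂ).re < 0 := by simpa using hε0
  set E₁ := expL2 _ hc1 with hE₁
  set E₂ := expL2 _ hc2 with hE₂
  set Φ : StarL2 N := WithLp.toLp 2 fun _ => WithLp.toLp 2 ![α • (E₁ - E₂), E₁ + E₂] with hΦ
  set F : StarL2 N := WithLp.toLp 2 fun _ => WithLp.toLp 2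
    ![(Complex.I * ε) • (E₁ + E₂), (Complex.I * ε) • α • (E₁ - E₂)] with hF
  have p0 : ∀ e, Φ e 0 = α • (E₁ - E₂) := fun e => rfl
  have p1 : ∀ e, Φ e 1 = E₁ + E₂ := fun e => rfl
  have q0 : ∀ e, F e 0 = (Complex.I * ε) • (E₁ + E₂) := fun e => rfl
  have q1 : ∀ e, F e 1 = (Complex.I * ε) • α • (E₁ - E₂) := fun e => rfl
  have t1 := hasTrace_expL2 hc1
  have t2 := hasTrace_expL2 hc2
  have d1 := isWeakDeriv_expL2 hc1
  have d2 := isWeakDeriv_expL2 hc2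
  rw [← hE₁] at t1 d1
  rw [← hE₂] at t2 d2
  have hI := Complex.I_mul_I
  have hz : z - m = k / α := by rw [← h2]; field_simp
  obtain ⟨x, hx, hxF⟩ := (diracAB_sub_eq_iff m 1 0 z Φ F).mpr (by
    refine ⟨⟨0, fun _ => Complex.I • 2, fun e => ⟨?_, ?_⟩, by simp [mem_relation]⟩,
      fun e => ⟨?_, ?_⟩⟩
    · rw [p0]
      convert (t1.add (t2.smul (-1))).smul α using 1
      · module
      · simp
    · rw [p1]
      convert (t1.add t2).smul Complex.I using 2
      norm_num
    · rw [p0, p1, q1, h1]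
      convert (d1.add (d2.smul (-1))).smul α using 1
      · module
      · match_scalars
        · linear_combination α * ε * hI
        · linear_combination -α * ε * hI
    · rw [p0, p1, q0, hz]
      convert d1.add d2 using 1
      match_scalars
      · field_simp
        linear_combination ε * hI
      · field_simp
        linear_combination ε * hI)
  have hnF : ‖F‖ = ε * ‖Φ‖ := by
    refine (sq_eq_sq₀ (norm_nonneg _) (by positivity)).mp ?_
    have hn : ‖Complex.I * (ε : ℂ)‖ = ε := by
      rw [norm_mul, Complex.norm_I, one_mul, Complex.norm_real, Real.norm_of_nonneg hε0.le]
    rw [mul_pow, PiLp.norm_sq_eq_of_L2, PiLp.norm_sq_eq_of_L2, Finset.mul_sum]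
    refine Finset.sum_congr rfl fun e _ => ?_
    rw [PiLp.norm_sq_eq_of_L2, PiLp.norm_sq_eq_of_L2, Fin.sum_univ_two, Fin.sum_univ_two,
      p0, p1, q0, q1, norm_smul _ (E₁ + E₂), norm_smul _ (α • _), hn]
    ring
  have hΦ0 : 0 < ‖Φ‖ := by
    rw [norm_pos_iff]
    intro h0
    have ht := t1.add t2
    rw [← p1 ⟨0, hN⟩, h0] at ht
    exact absurd (ht.unique hasTrace_zero) (by norm_num)
  have hle : ‖Φ‖ ≤ ‖R‖ * (ε * ‖Φ‖) := by
    rw [← hnF, ← hxF]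
    refine le_trans (le_of_eq ?_) (R.le_opNorm _)
    rw [hR x, hx]
  have : ‖R‖ * ε < 1 := by
    rw [hε, mul_one_div, div_lt_one (by positivity)]
    linarith
  nlinarith

/-! ### The momentum and the function `α` -/

lemma momentum_sq (m : ℝ) (z : ℂ) : momentum m z ^ 2 = z ^ 2 - (m : ℂ) ^ 2 := by
  have h := Complex.cpow_nat_inv_pow (z ^ 2 - (m : ℂ) ^ 2) (two_ne_zero)
  rw [momentum]
  simp only [one_div]
  split_ifs
  · exact h
  · rw [neg_sq]
    exact h

lemma momentum_im_nonneg (m : ℝ) (z : ℂ) : 0 ≤ (momentum m z).im := by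
  rw [momentum]
  split_ifs with h
  · exact Complex.arg_nonneg_iff.mp h
  · rw [Complex.neg_im]
    linarith [Complex.arg_neg_iff.mp (not_le.mp h)]

/-- `momentum m z` is the only square root of `z² - m²` in the open upper half-plane, if there is
one. -/
lemma momentum_eq {m : ℝ} {z k : ℂ} (hk : 0 < k.im) (h : k ^ 2 = z ^ 2 - (m : ℂ) ^ 2) :
    momentum m z = k := by
  rw [← momentum_sq] at h
  rcases sq_eq_sq_iff_eq_or_eq_neg.mp h with h | h
  · exact h.symm
  · have := momentum_im_nonneg m z
    rw [h, Complex.neg_im] at hk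
    linarith

lemma mem_real_rays_iff {m : ℝ} {z : ℂ} :
    z ∈ Complex.ofReal '' (Iic (-m) ∪ Ici m) ↔ z.im = 0 ∧ (z.re ≤ -m ∨ m ≤ z.re) := by
  constructor
  · rintro ⟨r, hr, rfl⟩
    exact ⟨Complex.ofReal_im r, hr⟩
  · rintro ⟨h1, h2⟩
    exact ⟨z.re, h2, Complex.ext rfl h1.symm⟩

lemma notMem_real_rays_of_im_pos {m : ℝ} {z k : ℂ} (hk : 0 < k.im) (h : k ^ 2 = z ^ 2 - (m : ℂ) ^ 2)
    (hm : 0 ≤ m) : z ∉ Complex.ofReal '' (Iic (-m) ∪ Ici m) := by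
  rw [mem_real_rays_iff]
  rintro ⟨h1, h2⟩
  have hre := congrArg Complex.re h
  have him := congrArg Complex.im h
  simp only [sq, Complex.mul_re, Complex.mul_im, Complex.sub_re, Complex.sub_im, h1,
    Complex.ofReal_re, Complex.ofReal_im] at hre him
  have hk0 : k.re = 0 := by
    have : k.re * k.im = 0 := by linarith
    exact (mul_eq_zero.mp this).resolve_right hk.ne'
  rw [hk0] at hre
  rcases h2 with h2 | h2 <;> nlinarith

lemma momentum_im_pos {m : ℝ} {z : ℂ}
    (hz : z ∉ Complex.ofReal '' (Iic (-m) ∪ Ici m)) : 0 < (momentum m z).im := by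
  refine lt_of_le_of_ne (momentum_im_nonneg m z) fun h0 => hz ?_
  have h := momentum_sq m z
  have hre := congrArg Complex.re h
  have him := congrArg Complex.im h
  simp only [sq, Complex.mul_re, Complex.mul_im, Complex.sub_re, Complex.sub_im, ← h0,
    Complex.ofReal_re, Complex.ofReal_im] at hre him
  have h1 : z.re * z.im = 0 := by linarith
  have h2 : z.im = 0 := by
    rcases mul_eq_zero.mp h1 with h3 | h3
    · rw [h3] at hre
      nlinarith [sq_nonneg (momentum m z).re, sq_nonneg z.im, sq_nonneg m]
    · exact h3
  rw [h2] at hre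
  refine mem_real_rays_iff.mpr ⟨h2, ?_⟩
  have : m ^ 2 ≤ z.re ^ 2 := by nlinarith [sq_nonneg (momentum m z).re]
  rcases le_total 0 z.re with h3 | h3
  · right
    nlinarith
  · left
    nlinarith

lemma alpha_spec {m : ℝ} {z : ℂ} (hk : 0 < (momentum m z).im) :
    alpha m z ≠ 0 ∧ z + m = momentum m z * alpha m z ∧ alpha m z * (z - m) = momentum m z := by
  have hk0 : momentum m z ≠ 0 := fun h => by simp [h] at hk
  have h := momentum_sq m z
  have hz : z - m ≠ 0 := by
    intro h0
    refine hk0 (pow_eq_zero_iff (two_ne_zero) |>.mp ?_)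
    rw [h]
    linear_combination (z + m) * h0
  refine ⟨div_ne_zero hk0 hz, ?_, div_mul_cancel₀ _ hz⟩
  rw [alpha]
  field_simp
  linear_combination -h

lemma re_inv_neg_iff {w : ℂ} : (w⁻¹).re < 0 ↔ w.re < 0 := by
  rcases eq_or_ne w 0 with rfl | hw
  · simp
  · rw [Complex.inv_re, div_lt_iff₀ (Complex.normSq_pos.mpr hw), zero_mul]

lemma re_add_inv_neg_iff {w : ℂ} : (w + w⁻¹).re < 0 ↔ w.re < 0 := by
  have h := re_inv_neg_iff (w := w)
  have h' := re_inv_neg_iff (w := -w)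
  rw [inv_neg, Complex.neg_re, Complex.neg_re, neg_lt_zero, neg_lt_zero] at h'
  rw [Complex.add_re]
  constructor
  · intro h1
    by_contra h2
    have : ¬ (w⁻¹).re < 0 := fun h3 => h2 (h.mp h3)
    linarith
  · intro h1
    linarith [h.mpr h1]

/-- The condition `Im k > 0` in terms of `μ = i / α`, as `k = -2 i m (μ + μ⁻¹)⁻¹`. -/
lemma im_neg_two_I_mul_pos_iff {m : ℝ} (hm : 0 < m) {μ : ℂ} :
    0 < (-2 * Complex.I * m * (μ + μ⁻¹)⁻¹).im ↔ μ.re < 0 := by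
  have e : (-2 * Complex.I * m * (μ + μ⁻¹)⁻¹).im = 2 * m * -((μ + μ⁻¹)⁻¹).re := by
    simp [Complex.mul_im, Complex.mul_re]
  rw [e, mul_pos_iff_of_pos_left (by linarith), neg_pos, re_inv_neg_iff, re_add_inv_neg_iff]

/-- The relation `μ = i / α(z)` solved for `z`. -/
theorem notMem_and_eq_I_div_alpha_iff {m : ℝ} (hm : 0 < m) {z μ : ℂ} :
    z ∉ Complex.ofReal '' (Iic (-m) ∪ Ici m) ∧ μ = Complex.I / alpha m z ↔
      μ.re < 0 ∧ z = m * ((1 - μ ^ 2) / (1 + μ ^ 2)) := by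
  have hmC : (m : ℂ) ≠ 0 := Complex.ofReal_ne_zero.mpr hm.ne'
  have hI := Complex.I_mul_I
  constructor
  · rintro ⟨hz, hμ⟩
    have hk := momentum_im_pos hz
    obtain ⟨hα, h1, h2⟩ := alpha_spec hk
    have hμ0 : μ ≠ 0 := by
      rw [hμ]
      exact div_ne_zero Complex.I_ne_zero hα
    have hαμ : alpha m z * μ = Complex.I := by
      rw [hμ]
      field_simp
    have h3 : z * (1 + μ ^ 2) = m * (1 - μ ^ 2) := by
      linear_combination μ ^ 2 * h1 - μ ^ 2 * alpha m z * h2 +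
        (z - m) * (alpha m z * μ + Complex.I) * hαμ + (z - m) * hI
    have h4 : 1 + μ ^ 2 ≠ 0 := by
      intro h0
      have : 2 * (m : ℂ) = 0 := by linear_combination (z + m) * h0 - h3
      exact hmC (by simpa using this)
    have h5 : z = m * ((1 - μ ^ 2) / (1 + μ ^ 2)) := by
      rw [← mul_div_assoc, eq_div_iff h4, h3]
    refine ⟨(im_neg_two_I_mul_pos_iff hm).mp ?_, h5⟩
    have e : -2 * Complex.I * m * (μ + μ⁻¹)⁻¹ = momentum m z := by
      have h6 : μ + μ⁻¹ = (1 + μ ^ 2) / μ := by field_simp; ring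
      have h7 : alpha m z = Complex.I / μ := by rw [← hαμ]; field_simp
      rw [h6, ← h2, h7, h5]
      field_simp
      ring
    rw [e]
    exact hk
  · rintro ⟨hre, rfl⟩
    have hμ0 : μ ≠ 0 := by
      rintro rfl
      simp at hre
    have h6 : μ + μ⁻¹ = (1 + μ ^ 2) / μ := by field_simp; ring
    have h4 : 1 + μ ^ 2 ≠ 0 := by
      intro h0
      have := re_add_inv_neg_iff.mpr hre
      rw [h6, h0] at this
      simp at this
    have hk := (im_neg_two_I_mul_pos_iff hm).mpr hre
    have hsq : (-2 * Complex.I * m * (μ + μ⁻¹)⁻¹) ^ 2 =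
        (m * ((1 - μ ^ 2) / (1 + μ ^ 2))) ^ 2 - (m : ℂ) ^ 2 := by
      rw [h6]
      field_simp
      linear_combination 4 * μ ^ 2 * hI
    refine ⟨notMem_real_rays_of_im_pos hk hsq hm.le, ?_⟩
    have hd : m * ((1 - μ ^ 2) / (1 + μ ^ 2)) - (m : ℂ) = -2 * m * μ ^ 2 / (1 + μ ^ 2) := by
      field_simp
      ring
    rw [alpha, momentum_eq hk hsq, hd, h6]
    field_simp

lemma alpha_zero_of_im_pos {z : ℂ} (hz : 0 < z.im) : alpha 0 z = 1 := by
  have hz0 : z ≠ 0 := fun h => by simp [h] at hz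
  rw [alpha, momentum_eq hz (by simp), Complex.ofReal_zero, sub_zero, div_self hz0]

lemma alpha_zero_of_im_neg {z : ℂ} (hz : z.im < 0) : alpha 0 z = -1 := by
  have hz0 : z ≠ 0 := fun h => by simp [h] at hz
  rw [alpha, momentum_eq (k := -z) (by simpa using hz) (by simp), Complex.ofReal_zero, sub_zero,
    neg_div, div_self hz0]

/-! ### The spectrum of the reference operator -/

/-- Off the two rays, `z` is in the resolvent set since the pencil of `diracZero`, `1 - μ • 0`, is
regular; the open rays consist of approximate eigenvalues, and their endpoints are covered by
closedness of the spectrum. -/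
theorem spec_diracZero (hN : 1 ≤ N) {m : ℝ} (hm : 0 ≤ m) :
    spec (diracZero N m) = Complex.ofReal '' (Iic (-m) ∪ Ici m) := by
  refine Subset.antisymm ?_ ?_
  · rw [← compl_subset_compl]
    intro z hz
    have hk := momentum_im_pos hz
    obtain ⟨hα, h1, h2⟩ := alpha_spec hk
    rw [spec, compl_compl, diracZero_eq_diracAB]
    exact mem_resolventSet_of_det_ne_zero 1 0 hk hα h1 h2 (by simp [pencil])
  · have hsub : Complex.ofReal '' (Iio (-m) ∪ Ioi m) ⊆ spec (diracZero N m) := by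
      rintro _ ⟨r, hr, rfl⟩
      have hr2 : m ^ 2 < r ^ 2 := by
        rcases hr with hr | hr
        · have : r < -m := hr
          nlinarith
        · have : m < r := hr
          nlinarith
      have hrm : r - m ≠ 0 := fun h => by
        rw [sub_eq_zero.mp h] at hr2
        exact lt_irrefl _ hr2
      set k := Real.sqrt (r ^ 2 - m ^ 2) with hk
      have hk0 : 0 < k := Real.sqrt_pos.mpr (by linarith)
      have hk2 : k ^ 2 = r ^ 2 - m ^ 2 := Real.sq_sqrt (by linarith)
      refine mem_spec_diracZero hN (k := k) (α := ((k / (r - m) : ℝ) : ℂ)) ?_ ?_ ?_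
      · exact Complex.ofReal_ne_zero.mpr (div_ne_zero hk0.ne' hrm)
      · norm_cast
        field_simp
        linarith
      · norm_cast
        field_simp
    rw [← closure_Iio, ← closure_Ioi, ← closure_union]
    exact (image_closure_subset_closure_image Complex.continuous_ofReal).trans
      ((isClosed_spec _).closure_subset_iff.mpr hsub)

/-! ### The matrix pencil -/

lemma pencilSpec_eq (A B : Matrix (Fin N) (Fin N) ℂ) :
    pencilSpec A B = {μ | (pencil A B μ).det = 0} := by
  ext μ
  rw [pencilSpec, mem_ofPred_eq, mem_ofPred_eq, spectrum.zero_mem_iff,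
    Matrix.isUnit_iff_isUnit_det, isUnit_iff_ne_zero, not_not]

/-- The characteristic polynomial of a pencil has degree at most `N`. -/
lemma pencilSpec_finite_and_ncard_le (A B : Matrix (Fin N) (Fin N) ℂ)
    (h : ∃ μ, (pencil A B μ).det ≠ 0) :
    (pencilSpec A B).Finite ∧ (pencilSpec A B).ncard ≤ N := by
  set p : Polynomial ℂ := Matrix.det ((Polynomial.X : Polynomial ℂ) • (-B).map Polynomial.C +
    A.map Polynomial.C) with hp
  have heval : ∀ μ, p.eval μ = (pencil A B μ).det := by
    intro μ
    rw [hp, ← Polynomial.coe_evalRingHom, RingHom.map_det]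
    congr 1
    ext i j
    simp [pencil]
    ring
  have hp0 : p ≠ 0 := by
    rintro h0
    obtain ⟨μ, hμ⟩ := h
    rw [← heval, h0, Polynomial.eval_zero] at hμ
    exact hμ rfl
  have hset : pencilSpec A B = (p.roots.toFinset : Set ℂ) := by
    ext μ
    rw [pencilSpec_eq]
    simp [hp0, heval]
  rw [hset]
  refine ⟨Finset.finite_toSet _, ?_⟩
  rw [ncard_coe_finset]
  calc _ ≤ p.roots.card := Multiset.toFinset_card_le _
    _ ≤ p.natDegree := p.card_roots'
    _ ≤ Fintype.card (Fin N) := Polynomial.natDegree_det_X_add_C_le _ _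
    _ = N := Fintype.card_fin N

/-! ### The correspondence of eigenvalues with the pencil -/

lemma mem_pointSpec_iff_mem_pencilSpec {m : ℝ} (A B : Matrix (Fin N) (Fin N) ℂ)
    {z : ℂ} (hz : z ∉ Complex.ofReal '' (Iic (-m) ∪ Ici m)) :
    z ∈ pointSpec (diracAB m A B) ↔ Complex.I / alpha m z ∈ pencilSpec A B := by
  have hk := momentum_im_pos hz
  obtain ⟨hα, h1, h2⟩ := alpha_spec hk
  rw [mem_pointSpec_iff A B hk hα h1 h2, pencilSpec_eq]
  rfl

lemma upperHalf_subset_compl (m : ℝ) :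
    upperHalf ⊆ (Complex.ofReal '' (Iic (-m) ∪ Ici m))ᶜ :=
  fun _ hz h => (ne_of_gt hz) (mem_real_rays_iff.mp h).1

lemma lowerHalf_subset_compl (m : ℝ) :
    lowerHalf ⊆ (Complex.ofReal '' (Iic (-m) ∪ Ici m))ᶜ :=
  fun _ hz h => (ne_of_lt hz) (mem_real_rays_iff.mp h).1

lemma closure_upperHalf_union_lowerHalf : closure upperHalf ∪ closure lowerHalf = univ := by
  have h1 : closure upperHalf = {z | 0 ≤ z.im} := Complex.closure_setOfPred_lt_im 0
  have h2 : closure lowerHalf = {z | z.im ≤ 0} := Complex.closure_setOfPred_im_lt 0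
  rw [h1, h2, eq_univ_iff_forall]
  exact fun z => le_total 0 z.im

lemma closure_subset_spec {m : ℝ} {A B : Matrix (Fin N) (Fin N) ℂ} {U : Set ℂ}
    (h : U ⊆ pointSpec (diracAB m A B)) : closure U ⊆ spec (diracAB m A B) :=
  (isClosed_spec _).closure_subset_iff.mpr (h.trans (pointSpec_subset_spec _))

/-- In the massless case `α` only takes the values `±1` off the real line. -/
lemma mem_pointSpec_zero_iff (A B : Matrix (Fin N) (Fin N) ℂ) {z : ℂ}
    (hz : z ∉ Complex.ofReal '' (Iic (-(0 : ℝ)) ∪ Ici 0)) :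
    z ∈ pointSpec (diracAB 0 A B) ↔
      (Complex.I ∈ pencilSpec A B ∧ z ∈ upperHalf) ∨
        (-Complex.I ∈ pencilSpec A B ∧ z ∈ lowerHalf) := by
  rw [mem_pointSpec_iff_mem_pencilSpec A B hz]
  have hz0 : z.im ≠ 0 := fun h => hz (mem_real_rays_iff.mpr
    ⟨h, by simpa using le_total z.re 0⟩)
  rcases lt_or_gt_of_ne hz0 with h | h
  · rw [alpha_zero_of_im_neg h, div_neg, div_one]
    simp [upperHalf, lowerHalf, h, h.le]
  · rw [alpha_zero_of_im_pos h, div_one]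
    simp [upperHalf, lowerHalf, h, h.le]

end StarDirac

end

open StarDirac

theorem proposition3p13 (N : ℕ) (hN : 1 ≤ N) (m : ℝ) (hm : 0 ≤ m)
    (A B : Matrix (Fin N) (Fin N) ℂ) :
    -- the spectrum of the reference operator
    spec (diracZero N m) = Complex.ofReal '' (Set.Iic (-m) ∪ Set.Ici m) ∧
    -- the description of the spectrum of the pencil
    pencilSpec A B = {μ | (pencil A B μ).det = 0} ∧
    -- (I) singular pencils
    ((∀ μ, (pencil A B μ).det = 0) →
      spec (diracAB m A B) = Set.univ ∧
      (spec (diracZero N m))ᶜ ⊆ pointSpec (diracAB m A B)) ∧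
    -- (II) pencils without eigenvalues
    ((∀ μ, (pencil A B μ).det ≠ 0) →
      ∀ z, z ∉ spec (diracZero N m) → z ∉ spec (diracAB m A B)) ∧
    -- (III) all other pencils
    ((∃ μ, (pencil A B μ).det ≠ 0) → (∃ μ, (pencil A B μ).det = 0) →
      -- finitely many, and at most `N`, eigenvalues of the pencil
      ((pencilSpec A B).Finite ∧ 1 ≤ (pencilSpec A B).ncard ∧ (pencilSpec A B).ncard ≤ N) ∧
      -- (III)(i) the points `±i`
      (m = 0 →
        (Complex.I ∈ pencilSpec A B →
          upperHalf ⊆ pointSpec (diracAB m A B) ∧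
          closure upperHalf ⊆ spec (diracAB m A B)) ∧
        (-Complex.I ∈ pencilSpec A B →
          lowerHalf ⊆ pointSpec (diracAB m A B) ∧
          closure lowerHalf ⊆ spec (diracAB m A B))) ∧
      (0 < m → ∀ μ ∈ pencilSpec A B, (μ = Complex.I ∨ μ = -Complex.I) →
        ∀ z, ¬ EigenvalueCorrespondsTo m A B z μ) ∧
      -- (III)(ii) the other points
      (∀ μ ∈ pencilSpec A B, μ.re < 0 → 0 < m →
        m * ((1 - μ ^ 2) / (1 + μ ^ 2)) ∈ pointSpec (diracAB m A B) ∧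
        ∀ z, EigenvalueCorrespondsTo m A B z μ ↔ z = m * ((1 - μ ^ 2) / (1 + μ ^ 2))) ∧
      (∀ μ ∈ pencilSpec A B, μ ≠ Complex.I → μ ≠ -Complex.I → ¬ (μ.re < 0 ∧ 0 < m) →
        ∀ z, ¬ EigenvalueCorrespondsTo m A B z μ) ∧
      -- every eigenvalue off the spectrum of the reference operator is one of the above
      (∀ z ∈ pointSpec (diracAB m A B), z ∉ spec (diracZero N m) →
        ∃ μ ∈ pencilSpec A B, EigenvalueCorrespondsTo m A B z μ) ∧
      (m = 0 → pointSpec (diracAB m A B) \ spec (diracZero N m) =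
        {z | (Complex.I ∈ pencilSpec A B ∧ z ∈ upperHalf) ∨
          (-Complex.I ∈ pencilSpec A B ∧ z ∈ lowerHalf)}) ∧
      (0 < m → pointSpec (diracAB m A B) \ spec (diracZero N m) =
        {z | ∃ μ ∈ pencilSpec A B, μ.re < 0 ∧ z = m * ((1 - μ ^ 2) / (1 + μ ^ 2))})) := by
  have hS := spec_diracZero hN hm
  have hP := pencilSpec_eq A B
  refine ⟨hS, hP, fun hdet => ?_, fun hdet z hz => ?_, fun hne hex => ?_⟩
  · have hsub : (spec (diracZero N m))ᶜ ⊆ pointSpec (diracAB m A B) := by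
      intro z hz
      rw [hS] at hz
      rw [mem_pointSpec_iff_mem_pencilSpec A B hz, hP]
      exact hdet _
    refine ⟨univ_subset_iff.mp ?_, hsub⟩
    rw [hS] at hsub
    rw [← closure_upperHalf_union_lowerHalf]
    exact union_subset (closure_subset_spec ((upperHalf_subset_compl m).trans hsub))
      (closure_subset_spec ((lowerHalf_subset_compl m).trans hsub))
  · rw [hS] at hz
    have hk := momentum_im_pos hz
    obtain ⟨hα, h1, h2⟩ := alpha_spec hk
    rw [spec, mem_compl_iff, not_not]
    exact mem_resolventSet_of_det_ne_zero A B hk hα h1 h2 (hdet _)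
  · obtain ⟨hfin, hcard⟩ := pencilSpec_finite_and_ncard_le A B hne
    have hpos : 1 ≤ (pencilSpec A B).ncard := by
      obtain ⟨μ, hμ⟩ := hex
      refine (ncard_pos hfin).mpr ⟨μ, ?_⟩
      rw [hP]
      exact hμ
    -- the correspondence in the massive case
    have hcorr : 0 < m → ∀ μ ∈ pencilSpec A B, ∀ z, EigenvalueCorrespondsTo m A B z μ ↔
        μ.re < 0 ∧ z = m * ((1 - μ ^ 2) / (1 + μ ^ 2)) := by
      intro hm0 μ hμ z
      rw [← notMem_and_eq_I_div_alpha_iff hm0, EigenvalueCorrespondsTo, hS]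
      refine ⟨fun h => h.2, fun h => ⟨?_, h⟩⟩
      rw [mem_pointSpec_iff_mem_pencilSpec A B h.1, ← h.2]
      exact hμ
    have hev : ∀ z ∈ pointSpec (diracAB m A B), z ∉ spec (diracZero N m) →
        ∃ μ ∈ pencilSpec A B, EigenvalueCorrespondsTo m A B z μ := by
      intro z hz hzS
      refine ⟨_, ?_, hz, hzS, rfl⟩
      rw [hS] at hzS
      exact (mem_pointSpec_iff_mem_pencilSpec A B hzS).mp hz
    refine ⟨⟨hfin, hpos, hcard⟩, ?_, ?_, ?_, ?_, hev, ?_, ?_⟩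
    · rintro rfl
      have key : ∀ z ∉ Complex.ofReal '' (Iic (-(0 : ℝ)) ∪ Ici 0), _ :=
        fun z hz => mem_pointSpec_zero_iff A B (z := z) hz
      refine ⟨fun hI => ?_, fun hI => ?_⟩
      · have hsub : upperHalf ⊆ pointSpec (diracAB 0 A B) := fun z hz =>
          (key z (upperHalf_subset_compl 0 hz)).mpr (Or.inl ⟨hI, hz⟩)
        exact ⟨hsub, closure_subset_spec hsub⟩
      · have hsub : lowerHalf ⊆ pointSpec (diracAB 0 A B) := fun z hz =>
          (key z (lowerHalf_subset_compl 0 hz)).mpr (Or.inr ⟨hI, hz⟩)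
        exact ⟨hsub, closure_subset_spec hsub⟩
    · rintro hm0 μ hμ hμI z hz
      have := ((hcorr hm0 μ hμ z).mp hz).1
      rcases hμI with rfl | rfl <;> simp at this
    · intro μ hμ hre hm0
      have h := fun z => hcorr hm0 μ hμ z
      refine ⟨((h _).mpr ⟨hre, rfl⟩).1, fun z => (h z).trans ⟨fun h => h.2, fun h => ⟨hre, h⟩⟩⟩
    · intro μ hμ hμI hμI' hnot z hz
      rcases hm.eq_or_lt with rfl | hm0
      · obtain ⟨-, hzS, hμz⟩ := hz
        rw [hS] at hzS
        have hz0 : z.im ≠ 0 := fun h => hzS (mem_real_rays_iff.mpr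
          ⟨h, by simpa using le_total z.re 0⟩)
        rcases lt_or_gt_of_ne hz0 with h | h
        · rw [alpha_zero_of_im_neg h, div_neg, div_one] at hμz
          exact hμI' hμz
        · rw [alpha_zero_of_im_pos h, div_one] at hμz
          exact hμI hμz
      · exact hnot ⟨((hcorr hm0 μ hμ z).mp hz).1, hm0⟩
    · rintro rfl
      ext z
      rw [hS, mem_sdiff]
      constructor
      · rintro ⟨hz, hzS⟩
        exact (mem_pointSpec_zero_iff A B hzS).mp hz
      · intro hz
        have hzS : z ∉ Complex.ofReal '' (Iic (-(0 : ℝ)) ∪ Ici 0) := by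
          rcases hz with h | h
          exacts [upperHalf_subset_compl 0 h.2, lowerHalf_subset_compl 0 h.2]
        exact ⟨(mem_pointSpec_zero_iff A B hzS).mpr hz, hzS⟩
    · intro hm0
      ext z
      constructor
      · rintro ⟨hz, hzS⟩
        obtain ⟨μ, hμ, h⟩ := hev z hz hzS
        exact ⟨μ, hμ, (hcorr hm0 μ hμ z).mp h⟩
      · rintro ⟨μ, hμ, h⟩
        have h' := (hcorr hm0 μ hμ z).mpr h
        exact ⟨h'.1, h'.2.1⟩
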